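/- **Setting.** Let $Q$ be a smooth finite-dimensional manifold with cotangent bundle $\pi_Q:T^*Q\to Q$, and let $B$ be a Poisson tensor on $T^*Q$, with $B(\alpha,\beta)=\langle\alpha,B^\sharp\beta\rangle$ and $\{f,g\}_B=B(\mathrm df,\mathrm dg)$. Let a Lie group $G$ act smoothly on $Q$ such that the cotangent lifted action $\Phi$ on $T^*Q$ preserves $B$. Let $H:T^*Q\to\mathbb R$ be a smooth $G$-invariant function, $F:T^*Q\to T^*Q$ a smooth fiber-preserving $G$-equivariant map, and $W\subset T^*Q$ a $G$-invariant embedded submanifold, with the relative topology (no further condition on the intersections of $W$ with the fibers is needed). Then $(T^*Q,G,B,H,F,W)$ is called a *symmetric CH system*. Fix a splitting of $TT^*Q$ into the vertical bundle $\ker T\pi_Q$ and a horizontal bundle. For a fiber-preserving map $u$ let $\mathrm{vlift}(u)(a)\in T_a(T^*Q)$ be the vertical part of $Tu(X_H(a))$, translated along the fiber from $u(a)$ to $a$, where $X_H=B^\sharp\mathrm dH$. A control law is a smooth fiber-preserving map $u:T^*Q\to W$; its closed-loop dynamics is $X_H+\mathrm{vlift}(F)+\mathrm{vlift}(u)$.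 Assume that $W$ is a *controllability submanifold*: any two points of $T^*Q$ are joined by a continuous curve $x:[0,1]\to T^*Q$ made of finitely many smooth pieces, each an integral curve of the closed-loop dynamics of some control law. Let $D^G\subset TT^*Q|_W$ be a *$G$-invariant controllability distribution*: a family of subspaces $D^G(z)\subset T_z(T^*Q)$, $z\in W$, with $T\Phi_g D^G(z)=D^G(\Phi_g(z))$, which is *Poisson* (if $f,g\in C^\infty(U)$, $U\subset T^*Q$ open, and $\mathrm df,\mathrm dg$ vanish on $D^G$ along $U\cap W$, then so does $\mathrm d\{f,g\}_B$) and such that $D_W=D^G\cap TW$ is smooth and integrable. Assume moreover that $D_W$ is regular, i.e. of locally constant rank. Let $\pi:W\to W/D_W$ be the projection to the space of maximal integral manifolds (accessible sets) of $D_W$, with the quotient topology. A subset of $W$ is *$D_W$-invariant* if it is invariant under the flows of all local sections of $D_W$; a subset $V\subset W/D_W$ is called $G$-invariant if $\pi^{-1}(V)$ is. $C^\infty(U)^G$ denotes the smooth functions $K$ on an open $G$-invariant set $U\subset T^*Q$ with $K\circ\Phi_g=K$ for all $g\in G$. For $V\subset W/D_W$ open and $G$-invariant and $k:V\to\mathbb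 R$, a *local extension* of $k\circ\pi$ at $m\in\pi^{-1}(V)$ is a function $K\in C^\infty(U_m)^G$ on an open $G$-invariant neighborhood $U_m$ of $m$ in $T^*Q$ such that $U_m\cap W$ is $D_W$-invariant and $K=k\circ\pi$ on $\pi^{-1}(V)\cap U_m$. It is *$D^G$-invariant* if in addition $\mathrm dK(y)|_{D^G(y)}=0$ for all $y\in\pi^{-1}(V)\cap U_m$. Let $C^\infty_{W/D_W}(V)$ be the set of those $k$ such that every point of $V$ is $\pi(m)$ for some $m$ at which $k\circ\pi$ has a local extension. Assume the *$(D^G,D_W)$-local extension property*: for all $V$ and all $k\in C^\infty_{W/D_W}(V)$, every point of $V$ is $\pi(m)$ for some $m$ at which $k\circ\pi$ has a local $D^G$-invariant extension. The system is *Poisson reducible by $D^G$* if there are brackets making $V\mapsto C^\infty_{W/D_W}(V)$ ($V$ open and $G$-invariant) a presheaf of Poisson algebras such that $$\{k,l\}_V(\pi(m))=\{K,L\}_B(m)$$ for all $k,l\in C^\infty_{W/D_W}(V)$, all $m\in\pi^{-1}(V)$ and all local $D^G$-invariant extensions $K,L\in C^\infty(U_m)^G$ of $k\circ\pi$, $l\circ\pi$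 at $m$. **Theorem 4.3.** Under these assumptions the symmetric CH system is Poisson reducible by $D^G$ if and only if $$B^\sharp(\Delta^G_z)\subset(\Delta^G_z)_W^\circ\qquad\text{for all }z\in W.$$ Here $\Delta^G_z$ is the set of all $\mathrm df(z)$ with $f\in C^\infty(U_z)^G$, $U_z$ an open $G$-invariant neighborhood of $z$ in $T^*Q$, and $\mathrm df(y)|_{D^G(y)}=0$ for all $y\in U_z\cap W$; $(\Delta^G_z)_W$ is the set of those $\mathrm df(z)$ for which $f$ is moreover constant on $U_z\cap W$; and $A^\circ=\{v\in T_z(T^*Q):\langle\alpha,v\rangle=0\ \forall\alpha\in A\}$. -/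

import Mathlib

open scoped Manifold ContDiff Topology
open Bundle Set

noncomputable section

namespace CHSystems

/-! ### Poisson structures, distributions and leaf spaces on general manifolds -/

section General

variable {EP : Type*} [NormedAddCommGroup EP] [NormedSpace ℝ EP]
  {HP : Type*} [TopologicalSpace HP] {I : ModelWithCorners ℝ EP HP}
  {P : Type*} [TopologicalSpace P] [ChartedSpace HP P]
  {EW : Type*} [NormedAddCommGroup EW] [NormedSpace ℝ EW]
  {W : Type*} [TopologicalSpace W] [ChartedSpace EW W]

variable (I) in
/-- The differential `df(z)` of a real function, as a covector at `z`. -/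
def dAt (f : P → ℝ) (z : P) : TangentSpace I z →L[ℝ] ℝ :=
  mfderiv I 𝓘(ℝ, ℝ) f z

variable (I P) in
/-- A Poisson structure on the (finite-dimensional) manifold `P`, given by the bundle map
`B♯ : T*P → TP` of its Poisson tensor `B(α, β) = ⟨α, B♯ β⟩`.  The tensor is antisymmetric, smooth
(brackets of smooth functions are smooth), and its bracket satisfies the Jacobi identity.
Bilinearity and the derivation property hold because the bracket of `f` and `g` is
`B(df, dg)`. -/
structure PoissonStructure where
  /-- the bundle map `B♯` -/
  sharp : ∀ z : P, (TangentSpace I z →L[ℝ] ℝ) →ₗ[ℝ] TangentSpace I z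
  skew : ∀ z (α β : TangentSpace I z →L[ℝ] ℝ), α (sharp z β) = - β (sharp z α)
  smooth : ∀ U : Set P, IsOpen U → ∀ f g : P → ℝ,
    ContMDiffOn I 𝓘(ℝ, ℝ) ∞ f U → ContMDiffOn I 𝓘(ℝ, ℝ) ∞ g U →
    ContMDiffOn I 𝓘(ℝ, ℝ) ∞ (fun z => dAt I f z (sharp z (dAt I g z))) U
  jacobi : ∀ U : Set P, IsOpen U → ∀ f g h : P → ℝ,
    ContMDiffOn I 𝓘(ℝ, ℝ) ∞ f U → ContMDiffOn I 𝓘(ℝ, ℝ) ∞ g U →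
    ContMDiffOn I 𝓘(ℝ, ℝ) ∞ h U → ∀ z ∈ U,
    dAt I f z (sharp z (dAt I (fun y => dAt I g y (sharp y (dAt I h y))) z)) +
    dAt I g z (sharp z (dAt I (fun y => dAt I h y (sharp y (dAt I f y))) z)) +
    dAt I h z (sharp z (dAt I (fun y => dAt I f y (sharp y (dAt I g y))) z)) = 0

namespace PoissonStructure

/-- The Poisson tensor `B(α, β) = ⟨α, B♯ β⟩`. -/
def tensor (B : PoissonStructure I P) (z : P) (α β : TangentSpace I z →L[ℝ] ℝ) : ℝ :=
  α (B.sharp z β)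

/-- The Poisson bracket `{f, g}(z) = B(z)(df(z), dg(z))`. -/
def bracket (B : PoissonStructure I P) (f g : P → ℝ) : P → ℝ :=
  fun z => B.tensor z (dAt I f z) (dAt I g z)

/-- A smooth self-map is Poisson if it preserves the Poisson tensor, equivalently if
`{f ∘ φ, g ∘ φ} = {f, g} ∘ φ`. -/
def IsPoissonMap (B : PoissonStructure I P) (φ : P → P) : Prop :=
  ContMDiff I I ∞ φ ∧
  ∀ (z : P) (α β : TangentSpace I (φ z) →L[ℝ] ℝ),
    B.tensor z (α.comp (mfderiv I I φ z)) (β.comp (mfderiv I I φ z)) = B.tensor (φ z) α β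

end PoissonStructure

/-! #### Generalized distributions -/

variable [IsManifold 𝓘(ℝ, EW) ∞ W]

/-- A smooth section over the open set `O` of a generalized distribution. -/
def IsLocalSection (D : ∀ n : W, Submodule ℝ (TangentSpace 𝓘(ℝ, EW) n)) (O : Set W)
    (X : ∀ n : W, TangentSpace 𝓘(ℝ, EW) n) : Prop :=
  IsOpen O ∧
  ContMDiffOn 𝓘(ℝ, EW) 𝓘(ℝ, EW).tangent ∞ (fun n => (⟨n, X n⟩ : TangentBundle 𝓘(ℝ, EW) W)) O ∧
  ∀ n ∈ O, X n ∈ D n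

/-- Smooth (differentiable) generalized distributions. -/
def IsSmoothDistribution (D : ∀ n : W, Submodule ℝ (TangentSpace 𝓘(ℝ, EW) n)) : Prop :=
  ∀ n, ∀ v ∈ D n, ∃ O X, n ∈ O ∧ IsLocalSection D O X ∧ X n = v

/-- Regular distributions: the rank is locally constant. -/
def IsRegularDistribution (D : ∀ n : W, Submodule ℝ (TangentSpace 𝓘(ℝ, EW) n)) : Prop :=
  ∀ n, ∀ᶠ n' in 𝓝 n, Module.finrank ℝ (D n') = Module.finrank ℝ (D n)

/-- (Completely) integrable distributions: through every point passes a connected, injectively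
immersed integral manifold `j : L → W` that is everywhere of maximal dimension, `T L = D`. -/
def IsIntegrableDistribution.{u} {W : Type u} [TopologicalSpace W] [ChartedSpace EW W]
    (D : ∀ n : W, Submodule ℝ (TangentSpace 𝓘(ℝ, EW) n)) : Prop :=
  ∀ n, ∃ (k : ℕ) (L : Type u) (_ : TopologicalSpace L)
    (_ : ChartedSpace (EuclideanSpace ℝ (Fin k)) L) (_ : IsManifold (𝓡 k) ∞ L)
    (_ : ConnectedSpace L) (j : L → W),
    Manifold.IsImmersion (𝓡 k) 𝓘(ℝ, EW) ∞ j ∧ Function.Injective j ∧ n ∈ range j ∧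
    ∀ l, LinearMap.range (mfderiv (𝓡 k) 𝓘(ℝ, EW) j l).toLinearMap = D (j l)

/-- `a` and `b` lie on one integral curve of a local section of `D`. -/
def FlowStep (D : ∀ n : W, Submodule ℝ (TangentSpace 𝓘(ℝ, EW) n)) (a b : W) : Prop :=
  ∃ (O : Set W) (X : ∀ n : W, TangentSpace 𝓘(ℝ, EW) n) (γ : ℝ → W) (s t : ℝ),
    IsLocalSection D O X ∧ (∀ r ∈ uIcc s t, γ r ∈ O) ∧
    IsMIntegralCurveOn (I := 𝓘(ℝ, EW)) γ X (uIcc s t) ∧ γ s = a ∧ γ t = b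

/-- `A` is invariant under the flows of all local sections of `D`. -/
def IsFlowInvariant (D : ∀ n : W, Submodule ℝ (TangentSpace 𝓘(ℝ, EW) n)) (A : Set W) : Prop :=
  ∀ a b, FlowStep D a b → a ∈ A → b ∈ A

/-- The leaf space `W / D`: the points of `W` modulo the accessible sets of `D`, that is, two
points are identified if finitely many integral curves of sections of `D` join them.  For an
integrable `D` these classes are the maximal integral manifolds.  It carries the quotient
topology, and the projection is `Quot.mk _`. -/
abbrev LeafSpace (D : ∀ n : W, Submodule ℝ (TangentSpace 𝓘(ℝ, EW) n)) : Type _ :=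
  Quot (FlowStep D)

/-- The projection `π : W → W / D`. -/
def leafProj (D : ∀ n : W, Submodule ℝ (TangentSpace 𝓘(ℝ, EW) n)) (n : W) : LeafSpace D :=
  Quot.mk _ n

theorem FlowStep.symm {D : ∀ n : W, Submodule ℝ (TangentSpace 𝓘(ℝ, EW) n)} {a b : W}
    (h : FlowStep D a b) : FlowStep D b a := by
  obtain ⟨O, X, γ, s, t, h1, h2, h3, h4, h5⟩ := h
  exact ⟨O, X, γ, t, s, h1, uIcc_comm s t ▸ h2, uIcc_comm s t ▸ h3, h5, h4⟩

theorem IsFlowInvariant.mem_of_leafProj_eq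
    {D : ∀ n : W, Submodule ℝ (TangentSpace 𝓘(ℝ, EW) n)} {A : Set W} (hA : IsFlowInvariant D A)
    {a b : W} (h : leafProj D a = leafProj D b) (ha : a ∈ A) : b ∈ A := by
  have key : ∀ a b, Relation.EqvGen (FlowStep D) a b → (a ∈ A ↔ b ∈ A) := by
    intro a b hab
    induction hab with
    | rel a b hab => exact ⟨hA a b hab, hA b a hab.symm⟩
    | refl a => exact Iff.rfl
    | symm a b _ ih => exact ih.symm
    | trans a b c _ _ ih1 ih2 => exact ih1.trans ih2
  exact (key a b (Quot.eqvGen_exact h)).1 ha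

/-! #### Distributions along a submanifold

The submanifold is a smooth embedding `ι : W → P`.  A generalized distribution in `TP|_W` is a
family `D z ⊆ T_z P`; only its values at the points `z` of `range ι` are ever used. -/

/-- The induced distribution `D_W = D ∩ TW` on `W`. -/
def restrictDist (ι : W → P) (D : ∀ z : P, Submodule ℝ (TangentSpace I z)) :
    ∀ n : W, Submodule ℝ (TangentSpace 𝓘(ℝ, EW) n) :=
  fun n => (D (ι n)).comap (mfderiv 𝓘(ℝ, EW) I ι n).toLinearMap

/-- `dF` vanishes on `D` at all points of `A ∩ U`, where `A` is a subset of the submanifold. -/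
def KillsOn (ι : W → P) (D : ∀ z : P, Submodule ℝ (TangentSpace I z)) (F : P → ℝ) (A : Set W)
    (U : Set P) : Prop :=
  ∀ n ∈ A, ι n ∈ U → ∀ v ∈ D (ι n), dAt I F (ι n) v = 0

/-- `D` is Poisson (canonical): if smooth functions `f`, `g` on an open subset `U` of `P` satisfy
`df|_D = dg|_D = 0`, then `d{f, g}|_D = 0`. -/
def IsPoissonDistribution (B : PoissonStructure I P) (ι : W → P)
    (D : ∀ z : P, Submodule ℝ (TangentSpace I z)) : Prop :=
  ∀ (U : Set P) (f g : P → ℝ), IsOpen U →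
    ContMDiffOn I 𝓘(ℝ, ℝ) ∞ f U → ContMDiffOn I 𝓘(ℝ, ℝ) ∞ g U →
    KillsOn ι D f univ U → KillsOn ι D g univ U → KillsOn ι D (B.bracket f g) univ U

/-! #### Group actions

`Φ g : P → P` is the action of `g` on `P`. -/

variable {G : Type*}

/-- `G`-invariant subsets.  (For a group action this says `Φ_g(A) = A` for all `g`.) -/
def IsGInvariantSet (Φ : G → P → P) (A : Set P) : Prop :=
  ∀ g, ∀ z ∈ A, Φ g z ∈ A

/-- `G`-invariant distributions along the submanifold: `TΦ_g D(z) = D(Φ_g z)`. -/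
def IsGInvariantDistribution (Φ : G → P → P) (ι : W → P)
    (D : ∀ z : P, Submodule ℝ (TangentSpace I z)) : Prop :=
  ∀ g n, (D (ι n)).map (mfderiv I I (Φ g) (ι n)).toLinearMap = D (Φ g (ι n))

variable (I) in
/-- `F ∈ C^∞(U)^G` for an open `G`-invariant set `U`. -/
structure IsInvariantSmoothOn (Φ : G → P → P) (U : Set P) (F : P → ℝ) : Prop where
  isOpen : IsOpen U
  invariant : IsGInvariantSet Φ U
  smooth : ContMDiffOn I 𝓘(ℝ, ℝ) ∞ F U
  comp_eq : ∀ g, ∀ z ∈ U, F (Φ g z) = F z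

/-- `Δ^G_z`: the differentials at `z` of `G`-invariant smooth functions `f` on open `G`-invariant
neighbourhoods `U` of `z` such that `df|_D = 0` on `U ∩ W`. -/
def invCodist (Φ : G → P → P) (ι : W → P) (D : ∀ z : P, Submodule ℝ (TangentSpace I z))
    (z : P) : Set (TangentSpace I z →L[ℝ] ℝ) :=
  {α | ∃ (U : Set P) (f : P → ℝ), z ∈ U ∧ IsInvariantSmoothOn I Φ U f ∧
    KillsOn ι D f univ U ∧ α = dAt I f z}

/-- `(Δ^G_z)_W`: the elements `df(z)` of `Δ^G_z` such that in addition `f` is constant on `U ∩ W`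
for some open `G`-invariant neighbourhood `U` of `z`. -/
def invCodistConst (Φ : G → P → P) (ι : W → P) (D : ∀ z : P, Submodule ℝ (TangentSpace I z))
    (z : P) : Set (TangentSpace I z →L[ℝ] ℝ) :=
  {α | ∃ (U : Set P) (f : P → ℝ), z ∈ U ∧ IsInvariantSmoothOn I Φ U f ∧
    KillsOn ι D f univ U ∧ (∃ c, ∀ n, ι n ∈ U → f (ι n) = c) ∧ α = dAt I f z}

/-- The annihilator in `T_z P` of a set of covectors at `z`. -/
def annihilatorOf {z : P} (A : Set (TangentSpace I z →L[ℝ] ℝ)) : Set (TangentSpace I z) :=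
  {v | ∀ α ∈ A, α v = 0}

/-! #### The presheaf of smooth functions on the leaf space -/

/-- Open `G`-invariant subsets of `W / D_W`: open sets whose preimage in `W` is `G`-invariant. -/
def InvOpens (Φ : G → P → P) (ι : W → P) (D : ∀ z : P, Submodule ℝ (TangentSpace I z)) : Type _ :=
  {V : Set (LeafSpace (restrictDist (EW := EW) ι D)) //
    IsOpen V ∧ IsGInvariantSet Φ (ι '' (leafProj (restrictDist ι D) ⁻¹' V))}

/-- `F ∈ C^∞(U)^G` is a local extension of `f ∘ π`: the open `G`-invariant set `U` meets `W` in a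
`D_W`-invariant set, and `f ∘ π = F` on `π⁻¹(V) ∩ U`. -/
structure IsLocalExtension (Φ : G → P → P) (ι : W → P)
    (D : ∀ z : P, Submodule ℝ (TangentSpace I z))
    (V : Set (LeafSpace (restrictDist (EW := EW) ι D))) (f : V → ℝ)
    (U : Set P) (F : P → ℝ) : Prop where
  inv : IsInvariantSmoothOn I Φ U F
  flow : IsFlowInvariant (restrictDist (EW := EW) ι D) (ι ⁻¹' U)
  eq : ∀ n (hn : leafProj (restrictDist ι D) n ∈ V), ι n ∈ U → F (ι n) = f ⟨_, hn⟩

/-- A local `D`-invariant extension: a local extension `F` of `f ∘ π` with `dF|_D = 0` on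
`π⁻¹(V) ∩ U`. -/
def IsLocalInvariantExtension (Φ : G → P → P) (ι : W → P)
    (D : ∀ z : P, Submodule ℝ (TangentSpace I z))
    (V : Set (LeafSpace (restrictDist (EW := EW) ι D))) (f : V → ℝ)
    (U : Set P) (F : P → ℝ) : Prop :=
  IsLocalExtension Φ ι D V f U F ∧ KillsOn ι D F (leafProj (restrictDist ι D) ⁻¹' V) U

/-- The algebra of smooth functions on `V ⊆ W / D_W`: every point of `V` is the class of a point
at which `f ∘ π` has a local extension. -/
def leafFunctions (Φ : G → P → P) (ι : W → P) (D : ∀ z : P, Submodule ℝ (TangentSpace I z))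
    (V : Set (LeafSpace (restrictDist (EW := EW) ι D))) : Subalgebra ℝ (V → ℝ) where
  carrier := {f | ∀ x ∈ V, ∃ n, leafProj (restrictDist ι D) n = x ∧
    ∃ U F, ι n ∈ U ∧ IsLocalExtension Φ ι D V f U F}
  mul_mem' := by
    intro a b ha hb x hx
    obtain ⟨n, hn, U, F, hU, hF⟩ := ha x hx
    obtain ⟨m, hm, U', F', hU', hF'⟩ := hb x hx
    refine ⟨n, hn, U ∩ U', fun z => F z * F' z, ⟨hU, ?_⟩, ⟨⟨hF.inv.isOpen.inter hF'.inv.isOpen,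
      fun g z hz => ⟨hF.inv.invariant g z hz.1, hF'.inv.invariant g z hz.2⟩, ?_, ?_⟩, ?_, ?_⟩⟩
    · exact hF'.flow.mem_of_leafProj_eq (hm.trans hn.symm) hU'
    · exact (hF.inv.smooth.mono inter_subset_left).mul (hF'.inv.smooth.mono inter_subset_right)
    · intro g z hz
      simp only [hF.inv.comp_eq g z hz.1, hF'.inv.comp_eq g z hz.2]
    · exact fun p q h hp => ⟨hF.flow p q h hp.1, hF'.flow p q h hp.2⟩
    · intro p hp hpU
      simp only [hF.eq p hp hpU.1, hF'.eq p hp hpU.2, Pi.mul_apply]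
  add_mem' := by
    intro a b ha hb x hx
    obtain ⟨n, hn, U, F, hU, hF⟩ := ha x hx
    obtain ⟨m, hm, U', F', hU', hF'⟩ := hb x hx
    refine ⟨n, hn, U ∩ U', fun z => F z + F' z, ⟨hU, ?_⟩, ⟨⟨hF.inv.isOpen.inter hF'.inv.isOpen,
      fun g z hz => ⟨hF.inv.invariant g z hz.1, hF'.inv.invariant g z hz.2⟩, ?_, ?_⟩, ?_, ?_⟩⟩
    · exact hF'.flow.mem_of_leafProj_eq (hm.trans hn.symm) hU'
    · exact (hF.inv.smooth.mono inter_subset_left).add (hF'.inv.smooth.mono inter_subset_right)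
    · intro g z hz
      simp only [hF.inv.comp_eq g z hz.1, hF'.inv.comp_eq g z hz.2]
    · exact fun p q h hp => ⟨hF.flow p q h hp.1, hF'.flow p q h hp.2⟩
    · intro p hp hpU
      simp only [hF.eq p hp hpU.1, hF'.eq p hp hpU.2, Pi.add_apply]
  algebraMap_mem' := by
    intro r x _
    obtain ⟨n, rfl⟩ := Quot.exists_rep x
    exact ⟨n, rfl, univ, fun _ => r, mem_univ _,
      ⟨isOpen_univ, fun _ _ _ => mem_univ _, contMDiffOn_const, fun _ _ _ => rfl⟩,
      fun _ _ _ _ => mem_univ _, fun _ _ _ => rfl⟩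

/-- The restriction maps of the presheaf. -/
def leafRestrict (Φ : G → P → P) (ι : W → P) (D : ∀ z : P, Submodule ℝ (TangentSpace I z))
    {V V' : Set (LeafSpace (restrictDist (EW := EW) ι D))} (h : V' ⊆ V)
    (f : leafFunctions Φ ι D V) : leafFunctions Φ ι D V' :=
  ⟨fun x => f.1 ⟨x.1, h x.2⟩, by
    intro x hx
    obtain ⟨n, hn, U, F, hU, hF⟩ := f.2 x (h hx)
    exact ⟨n, hn, U, F, hU, hF.inv, hF.flow, fun p hp hpU => hF.eq p (h hp) hpU⟩⟩

/-- The local extension property: local extensions can always be chosen `D`-invariant. -/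
def HasLocalExtensionProperty (Φ : G → P → P) (ι : W → P)
    (D : ∀ z : P, Submodule ℝ (TangentSpace I z)) : Prop :=
  ∀ (V : InvOpens (EW := EW) Φ ι D) (f : leafFunctions Φ ι D V.1), ∀ x ∈ V.1,
    ∃ n, leafProj (restrictDist ι D) n = x ∧
      ∃ U F, ι n ∈ U ∧ IsLocalInvariantExtension Φ ι D V.1 f.1 U F

/-- Poisson reducibility: the smooth functions on the leaf space form a presheaf of Poisson
algebras (over the open `G`-invariant sets), with bracket `{k, l}_V(π(n)) = {K, L}_B(n)` for
any local `D`-invariant extensions `K`, `L` of `k ∘ π`, `l ∘ π` at `n`. -/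
def IsPoissonReducible (B : PoissonStructure I P) (Φ : G → P → P) (ι : W → P)
    (D : ∀ z : P, Submodule ℝ (TangentSpace I z)) : Prop :=
  ∃ br : ∀ V : InvOpens (EW := EW) Φ ι D,
      leafFunctions Φ ι D V.1 →ₗ[ℝ] leafFunctions Φ ι D V.1 →ₗ[ℝ] leafFunctions Φ ι D V.1,
    (∀ V k l, br V k l = - br V l k) ∧
    (∀ V k l m, br V k (br V l m) + br V l (br V m k) + br V m (br V k l) = 0) ∧
    (∀ V k l m, br V k (l * m) = br V k l * m + l * br V k m) ∧
    (∀ (V V' : InvOpens (EW := EW) Φ ι D) (h : V'.1 ⊆ V.1) (k l : leafFunctions Φ ι D V.1),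
      leafRestrict Φ ι D h (br V k l) =
        br V' (leafRestrict Φ ι D h k) (leafRestrict Φ ι D h l)) ∧
    (∀ (V : InvOpens (EW := EW) Φ ι D) (k l : leafFunctions Φ ι D V.1) (n : W)
      (hn : leafProj (restrictDist ι D) n ∈ V.1) (U : Set P) (K L : P → ℝ), ι n ∈ U →
      IsLocalInvariantExtension Φ ι D V.1 k.1 U K →
      IsLocalInvariantExtension Φ ι D V.1 l.1 U L →
      (br V k l).1 ⟨_, hn⟩ = B.bracket K L (ι n))

end General

/-! ### Cotangent bundles and controlled Hamiltonian systems -/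

section Cotangent

variable (E : Type*) [NormedAddCommGroup E] [NormedSpace ℝ E]
  {Q : Type*} [TopologicalSpace Q] [ChartedSpace E Q]

/-- The cotangent space `T*_x Q`. -/
abbrev CotangentSpace (x : Q) : Type _ :=
  TangentSpace 𝓘(ℝ, E) x →L[ℝ] Bundle.Trivial Q ℝ x

variable (Q) in
/-- The cotangent bundle `T*Q`. -/
abbrev CotangentBundle : Type _ :=
  TotalSpace (E →L[ℝ] ℝ) (fun x : Q => CotangentSpace E x)

/-- The model with corners of the manifold `T*Q`. -/
abbrev cotModel : ModelWithCorners ℝ (E × (E →L[ℝ] ℝ)) (ModelProd E (E →L[ℝ] ℝ)) :=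
  𝓘(ℝ, E).prod 𝓘(ℝ, E →L[ℝ] ℝ)

variable {E} [IsManifold 𝓘(ℝ, E) ∞ Q]

/-- The vertical lift `d/ds|_{s=0} (a + s β)` in `T_a T*Q` of a covector `β` at the base point
of `a`. -/
def verticalLift (a : CotangentBundle E Q) (β : CotangentSpace E a.proj) :
    TangentSpace (cotModel E) a :=
  (mfderiv 𝓘(ℝ, ℝ) (cotModel E)
    (fun s : ℝ => (⟨a.proj, a.snd + s • β⟩ : CotangentBundle E Q)) 0 (1 : ℝ) :
    E × (E →L[ℝ] ℝ))

variable (E Q) in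
/-- A smooth fiber-preserving map `T*Q → T*Q`. -/
structure FiberMap where
  /-- the map on each fiber -/
  onFiber : ∀ x : Q, CotangentSpace E x → CotangentSpace E x
  smooth : ContMDiff (cotModel E) (cotModel E) ∞
    (fun a : CotangentBundle E Q => (⟨a.proj, onFiber a.proj a.snd⟩ : CotangentBundle E Q))

/-- The underlying map of total spaces. -/
def FiberMap.total (F : FiberMap E Q) (a : CotangentBundle E Q) : CotangentBundle E Q :=
  ⟨a.proj, F.onFiber a.proj a.snd⟩

variable (E Q) in
/-- A splitting `T T*Q = horizontal ⊕ vertical`, as in the definition of vertical parts of tangent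
vectors.  It is given by the map that sends a tangent vector to its vertical part, read as an
element of `T*_x Q` through the vertical lift; the horizontal bundle is the kernel. -/
structure VerticalSplitting where
  /-- the vertical part -/
  vert : ∀ a : CotangentBundle E Q, TangentSpace (cotModel E) a →ₗ[ℝ] CotangentSpace E a.proj
  vert_lift : ∀ a (β : CotangentSpace E a.proj), vert a (verticalLift a β) = β
  smooth : ContMDiff (cotModel E).tangent (cotModel E) ∞
    (fun v : TangentBundle (cotModel E) (CotangentBundle E Q) =>
      (⟨v.proj.proj, vert v.proj v.snd⟩ : CotangentBundle E Q))

/-- `vlift(F) X (a)`: the vertical part of `TF(X(a)) ∈ T_{F(a)} T*Q`, translated along the fiber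
from `F(a)` to `a`. -/
def vlift (𝒜 : VerticalSplitting E Q) (F : FiberMap E Q)
    (X : ∀ a : CotangentBundle E Q, TangentSpace (cotModel E) a) (a : CotangentBundle E Q) :
    TangentSpace (cotModel E) a :=
  verticalLift a (𝒜.vert (F.total a) (mfderiv (cotModel E) (cotModel E) F.total a (X a)))

variable (E Q) in
/-- A CH system `(T*Q, B, H, F, W)`: a Poisson structure on `T*Q`, a Hamiltonian, a force map and
a control subset, which is an embedded submanifold (the image of `ι`). -/
structure CHSystem (EW : Type*) [NormedAddCommGroup EW] [NormedSpace ℝ EW]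
    (W : Type*) [TopologicalSpace W] [ChartedSpace EW W] where
  /-- the Poisson structure on `T*Q` -/
  B : PoissonStructure (cotModel E) (CotangentBundle E Q)
  /-- the Hamiltonian -/
  H : CotangentBundle E Q → ℝ
  H_smooth : ContMDiff (cotModel E) 𝓘(ℝ, ℝ) ∞ H
  /-- the external force map -/
  F : FiberMap E Q
  /-- the inclusion of the control subset -/
  ι : W → CotangentBundle E Q
  ι_embedding : Manifold.IsSmoothEmbedding 𝓘(ℝ, EW) (cotModel E) ∞ ι

namespace CHSystem

variable {EW : Type*} [NormedAddCommGroup EW] [NormedSpace ℝ EW]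
  {W : Type*} [TopologicalSpace W] [ChartedSpace EW W] [IsManifold 𝓘(ℝ, EW) ∞ W]

/-- A control law: a fiber-preserving map from `T*Q` to the control subset. -/
def IsControlLaw (S : CHSystem E Q EW W) (u : FiberMap E Q) : Prop :=
  ∀ a, u.total a ∈ range S.ι

/-- The Hamiltonian vector field `X_H = B♯ dH`. -/
def hamiltonianField (S : CHSystem E Q EW W) (a : CotangentBundle E Q) :
    TangentSpace (cotModel E) a :=
  S.B.sharp a (dAt (cotModel E) S.H a)

/-- The dynamical vector field `X_H + vlift(F) X_H + vlift(u) X_H` of the closed-loop system. -/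
def dynamics (S : CHSystem E Q EW W) (𝒜 : VerticalSplitting E Q) (u : FiberMap E Q)
    (a : CotangentBundle E Q) : TangentSpace (cotModel E) a :=
  S.hamiltonianField a + vlift 𝒜 S.F S.hamiltonianField a + vlift 𝒜 u S.hamiltonianField a

/-- The control subset is a controllability submanifold: any two states `x₀`, `x₁` are joined by
a continuous curve `x : [0, 1] → T*Q` that consists of finitely many smooth pieces, each of which
is an integral curve of the closed-loop dynamics for some control law. -/
def IsControllabilitySubmanifold (S : CHSystem E Q EW W) (𝒜 : VerticalSplitting E Q) : Prop :=
  ∀ x₀ x₁ : CotangentBundle E Q, ∃ (x : ℝ → CotangentBundle E Q) (N : ℕ) (t : ℕ → ℝ),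
    ContinuousOn x (Icc 0 1) ∧ x 0 = x₀ ∧ x 1 = x₁ ∧
    t 0 = 0 ∧ t N = 1 ∧ (∀ i < N, t i < t (i + 1)) ∧
    ∀ i < N, ∃ u, S.IsControlLaw u ∧
      IsMIntegralCurveOn (I := cotModel E) x (S.dynamics 𝒜 u) (Icc (t i) (t (i + 1)))

/-- Controllability distributions: Poisson integrable (smooth) generalized distributions
`D ⊆ T T*Q|_W`, where smoothness and integrability refer to `D_W = D ∩ TW`. -/
def IsControllabilityDistribution (S : CHSystem E Q EW W)
    (D : ∀ z : CotangentBundle E Q, Submodule ℝ (TangentSpace (cotModel E) z)) : Prop :=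
  IsSmoothDistribution (restrictDist (EW := EW) S.ι D) ∧
  IsIntegrableDistribution (restrictDist (EW := EW) S.ι D) ∧
  IsPoissonDistribution S.B S.ι D

end CHSystem

/-- The cotangent lift of an action of `G` on `Q`: `g` sends `α ∈ T*_q Q` to
`α ∘ (T_q Φ_g)⁻¹ ∈ T*_{g q} Q`. -/
def cotangentLift {G : Type*} [SMul G Q] (g : G) (a : CotangentBundle E Q) :
    CotangentBundle E Q :=
  ⟨g • a.proj, a.snd.comp
    (mfderiv 𝓘(ℝ, E) 𝓘(ℝ, E) (fun q : Q => g • q) a.proj).inverse⟩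

variable (G : Type*) [SMul G Q] in
/-- A symmetric CH system: the lifted action is Poisson and `H`, `F`, `W` are `G`-invariant. -/
structure CHSystem.IsSymmetric {EW : Type*} [NormedAddCommGroup EW] [NormedSpace ℝ EW]
    {W : Type*} [TopologicalSpace W] [ChartedSpace EW W] (S : CHSystem E Q EW W) : Prop where
  poisson : ∀ g : G, S.B.IsPoissonMap (cotangentLift g)
  H_inv : ∀ (g : G) a, S.H (cotangentLift g a) = S.H a
  F_inv : ∀ (g : G) a, S.F.total (cotangentLift g a) = cotangentLift g (S.F.total a)
  W_inv : IsGInvariantSet (cotangentLift (E := E) (Q := Q) (G := G)) (range S.ι)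

end Cotangent

end CHSystems

end

/-!
*Sufficiency.* Two local extensions of one leaf function differ by a function vanishing on `W`, so
the annihilator condition says that the bracket of extensions is independent of the extensions.
The reduced bracket then inherits bilinearity, the Leibniz rule and the Jacobi identity from `B`.

*Necessity.* Let `f`, `g` be invariant functions whose differentials kill `D`, with `g = 0` on `W`.
For every smooth `h` the product `h * g` also kills `D`, so `D` being Poisson forces
`dh(v) {g, f} = d{h * g, f}(v) = 0` for `v ∈ D`. Hence `{g, f}` vanishes where `D ≠ 0` and, by
continuity, at limits of such points. At the remaining points `D = 0` nearby; there the leaves are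
single points, `f` and `g` descend to the leaf space, and `0` is another extension of the function
induced by `g`, so reducibility gives `{g, f} = {0, f} = 0`.
-/

namespace CHSystems

section Bracket

variable {EP : Type*} [NormedAddCommGroup EP] [NormedSpace ℝ EP]
  {HP : Type*} [TopologicalSpace HP] {I : ModelWithCorners ℝ EP HP}
  {P : Type*} [TopologicalSpace P] [ChartedSpace HP P]

/-! ### Differentials and brackets -/

theorem dAt_congr_of_isOpen {f g : P → ℝ} {U : Set P} (hU : IsOpen U) (h : EqOn f g U) {z : P}
    (hz : z ∈ U) : dAt I f z = dAt I g z :=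
  (Filter.eventuallyEq_of_mem (hU.mem_nhds hz) h).mfderiv_eq

theorem dAt_const (c : ℝ) (z : P) : dAt I (fun _ => c) z = 0 :=
  mfderiv_const

theorem dAt_add {f g : P → ℝ} {z : P} (hf : MDifferentiableAt I 𝓘(ℝ, ℝ) f z)
    (hg : MDifferentiableAt I 𝓘(ℝ, ℝ) g z) :
    dAt I (fun y => f y + g y) z = dAt I f z + dAt I g z :=
  (hf.hasMFDerivAt.add hg.hasMFDerivAt).mfderiv

theorem dAt_mul {f g : P → ℝ} {z : P} (hf : MDifferentiableAt I 𝓘(ℝ, ℝ) f z)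
    (hg : MDifferentiableAt I 𝓘(ℝ, ℝ) g z) :
    dAt I (fun y => f y * g y) z = f z • dAt I g z + g z • dAt I f z :=
  (hf.hasMFDerivAt.mul hg.hasMFDerivAt).mfderiv

theorem dAt_comp {φ : P → P} {f : P → ℝ} {z : P} (hf : MDifferentiableAt I 𝓘(ℝ, ℝ) f (φ z))
    (hφ : MDifferentiableAt I I φ z) :
    dAt I (fun y => f (φ y)) z = (dAt I f (φ z)).comp (mfderiv I I φ z) :=
  (hf.hasMFDerivAt.comp z hφ.hasMFDerivAt).mfderiv

theorem mdifferentiableAt_of_contMDiffOn {f : P → ℝ} {U : Set P}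
    (hf : ContMDiffOn I 𝓘(ℝ, ℝ) ∞ f U) (hU : IsOpen U) {z : P} (hz : z ∈ U) :
    MDifferentiableAt I 𝓘(ℝ, ℝ) f z :=
  (hf.contMDiffAt (hU.mem_nhds hz)).mdifferentiableAt (by simp)

theorem exists_dAt_ne_zero [IsManifold I ∞ P] {z : P} {v : TangentSpace I z} (hv : v ≠ 0) :
    ∃ (O : Set P) (h : P → ℝ), IsOpen O ∧ z ∈ O ∧ ContMDiffOn I 𝓘(ℝ, ℝ) ∞ h O ∧
      dAt I h z v ≠ 0 := by
  have : IsManifold I 1 P := IsManifold.of_le (n := ∞) (by simp)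
  obtain ⟨l, hl⟩ : ∃ l : EP →L[ℝ] ℝ, l v ≠ 0 :=
    SeparatingDual.exists_ne_zero (R := ℝ) (V := EP) hv
  have hchart : HasMFDerivAt I 𝓘(ℝ, EP) (extChartAt I z) z (ContinuousLinearMap.id ℝ _) := by
    rw [← mfderiv_extChartAt_self]
    exact (mdifferentiableAt_extChartAt (mem_chart_source _ _)).hasMFDerivAt
  have hderiv : dAt I (fun y => l (extChartAt I z y)) z = l.comp (ContinuousLinearMap.id ℝ _) :=
    (l.hasMFDerivAt.comp z hchart).mfderiv
  refine ⟨(chartAt HP z).source, fun y => l (extChartAt I z y), (chartAt HP z).open_source,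
    mem_chart_source _ _, l.contMDiff.comp_contMDiffOn contMDiffOn_extChartAt, ?_⟩
  rw [hderiv]
  exact hl

namespace PoissonStructure

variable (B : PoissonStructure I P)

theorem bracket_apply (f g : P → ℝ) (z : P) :
    B.bracket f g z = dAt I f z (B.sharp z (dAt I g z)) := rfl

theorem bracket_skew (f g : P → ℝ) (z : P) : B.bracket f g z = - B.bracket g f z :=
  B.skew z _ _

theorem bracket_const_left (c : ℝ) (g : P → ℝ) (z : P) : B.bracket (fun _ => c) g z = 0 := by
  rw [bracket_apply, dAt_const]
  rfl

theorem bracket_add_left {f f' : P → ℝ} (g : P → ℝ) {z : P}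
    (hf : MDifferentiableAt I 𝓘(ℝ, ℝ) f z) (hf' : MDifferentiableAt I 𝓘(ℝ, ℝ) f' z) :
    B.bracket (fun y => f y + f' y) g z = B.bracket f g z + B.bracket f' g z := by
  simp only [bracket_apply, dAt_add hf hf']
  rfl

theorem bracket_mul_left {f f' : P → ℝ} (g : P → ℝ) {z : P}
    (hf : MDifferentiableAt I 𝓘(ℝ, ℝ) f z) (hf' : MDifferentiableAt I 𝓘(ℝ, ℝ) f' z) :
    B.bracket (fun y => f y * f' y) g z = f z * B.bracket f' g z + f' z * B.bracket f g z := by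
  simp only [bracket_apply, dAt_mul hf hf']
  rfl

theorem bracket_mul_right (f : P → ℝ) {g g' : P → ℝ} {z : P}
    (hg : MDifferentiableAt I 𝓘(ℝ, ℝ) g z) (hg' : MDifferentiableAt I 𝓘(ℝ, ℝ) g' z) :
    B.bracket f (fun y => g y * g' y) z = g z * B.bracket f g' z + g' z * B.bracket f g z := by
  rw [bracket_skew, bracket_mul_left B f hg hg', B.bracket_skew f g, B.bracket_skew f g']
  ring

theorem bracket_const_mul_left {f : P → ℝ} (c : ℝ) (g : P → ℝ) {z : P}
    (hf : MDifferentiableAt I 𝓘(ℝ, ℝ) f z) :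
    B.bracket (fun y => c * f y) g z = c * B.bracket f g z := by
  rw [bracket_mul_left B g mdifferentiableAt_const hf, bracket_const_left, mul_zero, add_zero]

theorem IsPoissonMap.bracket_comp {B : PoissonStructure I P} {φ : P → P} (hφ : B.IsPoissonMap φ)
    {f g : P → ℝ} {z : P} (hf : MDifferentiableAt I 𝓘(ℝ, ℝ) f (φ z))
    (hg : MDifferentiableAt I 𝓘(ℝ, ℝ) g (φ z)) :
    B.bracket (fun y => f (φ y)) (fun y => g (φ y)) z = B.bracket f g (φ z) := by
  have hφz : MDifferentiableAt I I φ z := (hφ.1 z).mdifferentiableAt (by simp)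
  rw [bracket, dAt_comp hf hφz, dAt_comp hg hφz]
  exact hφ.2 z _ _

end PoissonStructure

end Bracket

section Basic

variable {EP : Type*} [NormedAddCommGroup EP] [NormedSpace ℝ EP]
  {HP : Type*} [TopologicalSpace HP] {I : ModelWithCorners ℝ EP HP}
  {P : Type*} [TopologicalSpace P] [ChartedSpace HP P]
  {W G : Type*} {Φ : G → P → P} {ι : W → P} {D : ∀ z : P, Submodule ℝ (TangentSpace I z)}
  {U U' : Set P} {f g : P → ℝ}

/-! ### Basic functions -/

namespace IsInvariantSmoothOn

theorem mdifferentiableAt (hf : IsInvariantSmoothOn I Φ U f) {z : P} (hz : z ∈ U) :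
    MDifferentiableAt I 𝓘(ℝ, ℝ) f z :=
  mdifferentiableAt_of_contMDiffOn hf.smooth hf.isOpen hz

theorem mono (hf : IsInvariantSmoothOn I Φ U f) (h : U' ⊆ U) (ho : IsOpen U')
    (hi : IsGInvariantSet Φ U') : IsInvariantSmoothOn I Φ U' f :=
  ⟨ho, hi, hf.smooth.mono h, fun γ z hz => hf.comp_eq γ z (h hz)⟩

theorem const (ho : IsOpen U) (hi : IsGInvariantSet Φ U) (c : ℝ) :
    IsInvariantSmoothOn I Φ U (fun _ => c) :=
  ⟨ho, hi, contMDiffOn_const, fun _ _ _ => rfl⟩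

theorem add (hf : IsInvariantSmoothOn I Φ U f) (hg : IsInvariantSmoothOn I Φ U g) :
    IsInvariantSmoothOn I Φ U (fun z => f z + g z) :=
  ⟨hf.isOpen, hf.invariant, hf.smooth.add hg.smooth, fun γ z hz => by
    simp only [hf.comp_eq γ z hz, hg.comp_eq γ z hz]⟩

theorem mul (hf : IsInvariantSmoothOn I Φ U f) (hg : IsInvariantSmoothOn I Φ U g) :
    IsInvariantSmoothOn I Φ U (fun z => f z * g z) :=
  ⟨hf.isOpen, hf.invariant, hf.smooth.mul hg.smooth, fun γ z hz => by
    simp only [hf.comp_eq γ z hz, hg.comp_eq γ z hz]⟩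

theorem bracket {B : PoissonStructure I P} (hΦ : ∀ γ, B.IsPoissonMap (Φ γ))
    (hf : IsInvariantSmoothOn I Φ U f) (hg : IsInvariantSmoothOn I Φ U g) :
    IsInvariantSmoothOn I Φ U (B.bracket f g) := by
  refine ⟨hf.isOpen, hf.invariant, B.smooth U hf.isOpen f g hf.smooth hg.smooth, fun γ z hz => ?_⟩
  have hz' : Φ γ z ∈ U := hf.invariant γ z hz
  have hdAt {h : P → ℝ} (hh : IsInvariantSmoothOn I Φ U h) :
      dAt I (fun y => h (Φ γ y)) z = dAt I h z :=
    dAt_congr_of_isOpen hh.isOpen (fun y hy => hh.comp_eq γ y hy) hz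
  rw [← (hΦ γ).bracket_comp (hf.mdifferentiableAt hz') (hg.mdifferentiableAt hz'),
    B.bracket_apply, hdAt hf, hdAt hg]
  rfl

end IsInvariantSmoothOn

variable (Φ ι D) in
/-- Basic functions on `U`: the `G`-invariant smooth functions on the open `G`-invariant set `U`
whose differential vanishes on `D` along the whole of `U ∩ W`. -/
structure IsBasicOn (U : Set P) (f : P → ℝ) : Prop extends IsInvariantSmoothOn I Φ U f where
  kills : KillsOn ι D f univ U

namespace IsBasicOn

theorem mono (hf : IsBasicOn Φ ι D U f) (h : U' ⊆ U) (ho : IsOpen U')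
    (hi : IsGInvariantSet Φ U') : IsBasicOn Φ ι D U' f :=
  ⟨hf.toIsInvariantSmoothOn.mono h ho hi, fun n hn hU => hf.kills n hn (h hU)⟩

theorem const (ho : IsOpen U) (hi : IsGInvariantSet Φ U) (c : ℝ) :
    IsBasicOn Φ ι D U (fun _ => c) :=
  ⟨.const ho hi c, fun n _ _ v _ => by rw [dAt_const]; rfl⟩

theorem add (hf : IsBasicOn Φ ι D U f) (hg : IsBasicOn Φ ι D U g) :
    IsBasicOn Φ ι D U (fun z => f z + g z) :=
  ⟨hf.toIsInvariantSmoothOn.add hg.toIsInvariantSmoothOn, fun n hn hU v hv => by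
    rw [dAt_add (hf.mdifferentiableAt hU) (hg.mdifferentiableAt hU), add_apply,
      hf.kills n hn hU v hv, hg.kills n hn hU v hv, add_zero]⟩

theorem mul (hf : IsBasicOn Φ ι D U f) (hg : IsBasicOn Φ ι D U g) :
    IsBasicOn Φ ι D U (fun z => f z * g z) :=
  ⟨hf.toIsInvariantSmoothOn.mul hg.toIsInvariantSmoothOn, fun n hn hU v hv => by
    rw [dAt_mul (hf.mdifferentiableAt hU) (hg.mdifferentiableAt hU), add_apply,
      smul_apply, smul_apply,
      hf.kills n hn hU v hv, hg.kills n hn hU v hv, smul_zero, smul_zero, add_zero]⟩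

theorem const_mul (hf : IsBasicOn Φ ι D U f) (c : ℝ) : IsBasicOn Φ ι D U (fun z => c * f z) :=
  (const hf.isOpen hf.invariant c).mul hf

theorem bracket {B : PoissonStructure I P} (hΦ : ∀ γ, B.IsPoissonMap (Φ γ))
    (hD : IsPoissonDistribution B ι D) (hf : IsBasicOn Φ ι D U f) (hg : IsBasicOn Φ ι D U g) :
    IsBasicOn Φ ι D U (B.bracket f g) :=
  ⟨hf.toIsInvariantSmoothOn.bracket hΦ hg.toIsInvariantSmoothOn,
    hD U f g hf.isOpen hf.smooth hg.smooth hf.kills hg.kills⟩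

end IsBasicOn

end Basic

section Saturation

/-! ### Group actions and saturated open sets -/

/-- The family `Φ` of self-maps is a left group action. -/
structure IsGroupAction {G P : Type*} [Group G] (Φ : G → P → P) : Prop where
  one_apply : ∀ z, Φ 1 z = z
  mul_apply : ∀ g h z, Φ (g * h) z = Φ g (Φ h z)

theorem IsGroupAction.inv_apply_apply {G P : Type*} [Group G] {Φ : G → P → P}
    (hΦ : IsGroupAction Φ) (g : G) (z : P) : Φ g⁻¹ (Φ g z) = z := by
  rw [← hΦ.mul_apply, inv_mul_cancel, hΦ.one_apply]

/-- The saturation of `O`, i.e. the union of the orbits that meet `O`, for a group action `Φ`. -/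
def gSaturation {G P : Type*} (Φ : G → P → P) (O : Set P) : Set P :=
  ⋃ g, Φ g ⁻¹' O

variable {G P W : Type*} {Φ : G → P → P} {ι : W → P} {A A' O : Set P}

theorem mem_gSaturation {z : P} : z ∈ gSaturation Φ O ↔ ∃ g, Φ g z ∈ O :=
  mem_iUnion

theorem isOpen_gSaturation [TopologicalSpace P] (hΦ : ∀ g, Continuous (Φ g)) (hO : IsOpen O) :
    IsOpen (gSaturation Φ O) :=
  isOpen_iUnion fun g => hO.preimage (hΦ g)

theorem IsGInvariantSet.inter (h : IsGInvariantSet Φ A) (h' : IsGInvariantSet Φ A') :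
    IsGInvariantSet Φ (A ∩ A') :=
  fun g z hz => ⟨h g z hz.1, h' g z hz.2⟩

section Group

variable [Group G] (hΦ : IsGroupAction Φ)
include hΦ

theorem subset_gSaturation : O ⊆ gSaturation Φ O :=
  fun z hz => mem_gSaturation.2 ⟨1, (hΦ.one_apply z).symm ▸ hz⟩

theorem isGInvariantSet_gSaturation : IsGInvariantSet Φ (gSaturation Φ O) := by
  intro h z hz
  obtain ⟨g, hg⟩ := mem_gSaturation.1 hz
  refine mem_gSaturation.2 ⟨g * h⁻¹, ?_⟩
  rwa [← hΦ.mul_apply, inv_mul_cancel_right]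

theorem inter_gSaturation (hA : IsGInvariantSet Φ A) (hAO : IsGInvariantSet Φ (A ∩ O)) :
    A ∩ gSaturation Φ O = A ∩ O := by
  refine (inter_subset_inter_right A (subset_gSaturation hΦ)).antisymm' fun z hz => ?_
  obtain ⟨g, hg⟩ := mem_gSaturation.1 hz.2
  exact hΦ.inv_apply_apply g z ▸ hAO g⁻¹ _ ⟨hA g z hz.1, hg⟩

theorem exists_invariant_isOpen_preimage_eq [TopologicalSpace P] [TopologicalSpace W]
    (hcont : ∀ g, Continuous (Φ g)) (hι : Topology.IsEmbedding ι)
    (hW : IsGInvariantSet Φ (range ι)) {S : Set W} (hS : IsOpen S)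
    (hSinv : IsGInvariantSet Φ (ι '' S)) :
    ∃ O : Set P, IsOpen O ∧ IsGInvariantSet Φ O ∧ ι ⁻¹' O = S := by
  obtain ⟨O, hO, rfl⟩ := hι.isOpen_iff.1 hS
  refine ⟨gSaturation Φ O, isOpen_gSaturation hcont hO, isGInvariantSet_gSaturation hΦ, ?_⟩
  rw [image_preimage_eq_range_inter] at hSinv
  rw [← preimage_range_inter, inter_gSaturation hΦ hW hSinv, preimage_range_inter]

end Group

end Saturation

section ZeroVelocity

variable {EP : Type*} [NormedAddCommGroup EP] [NormedSpace ℝ EP]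
  {HP : Type*} [TopologicalSpace HP] {I : ModelWithCorners ℝ EP HP}
  {P : Type*} [TopologicalSpace P] [ChartedSpace HP P] [IsManifold I 1 P]

/-! ### Curves with zero velocity -/

theorem eventually_eq_of_hasMFDerivWithinAt_zero {c : ℝ → P} {S : Set ℝ} (hS : Convex ℝ S) {r : ℝ}
    (hr : r ∈ S) (hc : ∀ᶠ q in 𝓝[S] r, HasMFDerivWithinAt 𝓘(ℝ, ℝ) I c S q 0) :
    ∀ᶠ q in 𝓝[S] r, c q = c r := by
  have hsource : ∀ᶠ q in 𝓝[S] r, c q ∈ (chartAt HP (c r)).source :=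
    (hc.self_of_nhdsWithin hr).continuousWithinAt.eventually_mem
      ((chartAt HP (c r)).open_source.mem_nhds (mem_chart_source _ _))
  obtain ⟨ε, hε, hball⟩ := Metric.mem_nhdsWithin_iff.1 (hc.and hsource)
  have hderiv : ∀ q ∈ Metric.ball r ε ∩ S, HasFDerivWithinAt (extChartAt I (c r) ∘ c)
      (0 : ℝ →L[ℝ] EP) (Metric.ball r ε ∩ S) q := fun q hq => by
    have hcomp := (mdifferentiableAt_extChartAt (I := I) (hball hq).2).hasMFDerivAt
      |>.comp_hasMFDerivWithinAt q ((hball hq).1.mono (inter_subset_right (s := Metric.ball r ε)))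
    exact hcomp.hasFDerivWithinAt.congr_fderiv (ContinuousLinearMap.comp_zero _)
  filter_upwards [inter_mem_nhdsWithin S (Metric.ball_mem_nhds r hε)] with q hq
  have hnorm := ((convex_ball r ε).inter hS).norm_image_sub_le_of_norm_hasFDerivWithin_le (C := 0)
    hderiv (fun _ _ => by simp) ⟨Metric.mem_ball_self hε, hr⟩ hq.symm
  rw [zero_mul, norm_le_zero_iff, sub_eq_zero] at hnorm
  refine (extChartAt I (c r)).injOn ?_ (mem_extChartAt_source _) hnorm
  rw [extChartAt_source]
  exact (hball hq.symm).2

theorem eq_of_hasMFDerivWithinAt_zero {c : ℝ → P} {s t : ℝ} (hc : ContinuousOn c (uIcc s t))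
    {O : Set P} (hO : IsOpen O) (hs : c s ∈ O)
    (hderiv : ∀ r ∈ uIcc s t, c r ∈ O → HasMFDerivWithinAt 𝓘(ℝ, ℝ) I c (uIcc s t) r 0) :
    c t = c s := by
  have : T1Space P := I.t1Space P
  have : PreconnectedSpace (uIcc s t) :=
    isPreconnected_iff_preconnectedSpace.1 isPreconnected_uIcc
  let level : Set (uIcc s t) := {r | c r = c s}
  have hclosed : IsClosed level :=
    isClosed_singleton.preimage (continuousOn_iff_continuous_domRestrict.1 hc)
  have hopen : IsOpen level := by
    refine isOpen_iff_mem_nhds.2 ?_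
    rintro ⟨r, hr⟩ (hrs : c r = c s)
    have hnear : ∀ᶠ q in 𝓝[uIcc s t] r, HasMFDerivWithinAt 𝓘(ℝ, ℝ) I c (uIcc s t) q 0 := by
      filter_upwards [(hc r hr).eventually_mem (hO.mem_nhds (hrs ▸ hs)), self_mem_nhdsWithin]
        with q hqO hq using hderiv q hq hqO
    have hconst := eventually_eq_of_hasMFDerivWithinAt_zero (convex_uIcc s t) hr hnear
    rw [nhdsWithin_eq_map_subtype_coe hr] at hconst
    exact (Filter.eventually_map.1 hconst).mono fun q hq => hq.trans hrs
  have huniv : level = univ := IsClopen.eq_univ ⟨hclosed, hopen⟩ ⟨⟨s, left_mem_uIcc⟩, rfl⟩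
  exact huniv.ge (mem_univ (⟨t, right_mem_uIcc⟩ : uIcc s t))

end ZeroVelocity

section Leaves

variable {EP : Type*} [NormedAddCommGroup EP] [NormedSpace ℝ EP]
  {HP : Type*} [TopologicalSpace HP] {I : ModelWithCorners ℝ EP HP}
  {P : Type*} [TopologicalSpace P] [ChartedSpace HP P]
  {EW : Type*} [NormedAddCommGroup EW] [NormedSpace ℝ EW]
  {W : Type*} [TopologicalSpace W] [ChartedSpace EW W]

/-! ### Leaves and flows -/

theorem hasMFDerivWithinAt_comp_zero_of_isMIntegralCurveOn {φ : W → P} {γ : ℝ → W}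
    {X : ∀ n : W, TangentSpace 𝓘(ℝ, EW) n} {T : Set ℝ}
    (hγ : IsMIntegralCurveOn (I := 𝓘(ℝ, EW)) γ X T) {r : ℝ} (hr : r ∈ T)
    (hφ : MDifferentiableAt 𝓘(ℝ, EW) I φ (γ r))
    (hX : mfderiv 𝓘(ℝ, EW) I φ (γ r) (X (γ r)) = 0) :
    HasMFDerivWithinAt 𝓘(ℝ, ℝ) I (φ ∘ γ) T r 0 := by
  have hcomp := hφ.hasMFDerivAt.comp_hasMFDerivWithinAt r (hγ r hr)
  have hzero : (mfderiv 𝓘(ℝ, EW) I φ (γ r)).comp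
      ((1 : ℝ →L[ℝ] ℝ).smulRight (X (γ r))) = 0 := by
    refine ContinuousLinearMap.ext fun a => ?_
    change mfderiv 𝓘(ℝ, EW) I φ (γ r) (a • X (γ r)) = 0
    rw [map_smul, hX, smul_zero]
  exact hcomp.congr_mfderiv hzero

variable [IsManifold 𝓘(ℝ, EW) ∞ W]

section Distribution

variable {Δ : ∀ n : W, Submodule ℝ (TangentSpace 𝓘(ℝ, EW) n)}

theorem leafProj_surjective : Function.Surjective (leafProj Δ) :=
  Quot.exists_rep

theorem IsFlowInvariant.inter {A A' : Set W} (h : IsFlowInvariant Δ A)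
    (h' : IsFlowInvariant Δ A') : IsFlowInvariant Δ (A ∩ A') :=
  fun a b hab ha => ⟨h a b hab ha.1, h' a b hab ha.2⟩

theorem isFlowInvariant_preimage_leafProj (V : Set (LeafSpace Δ)) :
    IsFlowInvariant Δ (leafProj Δ ⁻¹' V) := fun a b hab ha => by
  have hπ : leafProj Δ a = leafProj Δ b := Quot.sound hab
  rwa [mem_preimage, ← hπ]

theorem isOpen_preimage_leafProj {V : Set (LeafSpace Δ)} (hV : IsOpen V) :
    IsOpen (leafProj Δ ⁻¹' V) :=
  isOpen_coinduced.1 hV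

theorem IsFlowInvariant.preimage_image_leafProj {A : Set W} (hA : IsFlowInvariant Δ A) :
    leafProj Δ ⁻¹' (leafProj Δ '' A) = A :=
  Subset.antisymm (fun _ ⟨_, hb, hba⟩ => hA.mem_of_leafProj_eq hba hb) (subset_preimage_image _ A)

theorem IsFlowInvariant.eq_of_leafProj_eq {α : Type*} {A : Set W} (hA : IsFlowInvariant Δ A)
    {F : W → α} (hF : ∀ a b, FlowStep Δ a b → a ∈ A → F b = F a) {a b : W}
    (hab : leafProj Δ a = leafProj Δ b) (ha : a ∈ A) : F b = F a := by
  have hlevel : IsFlowInvariant Δ {n | n ∈ A ∧ F n = F a} :=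
    fun n m hnm hn => ⟨hA n m hnm hn.1, (hF n m hnm hn.1).trans hn.2⟩
  exact (hlevel.mem_of_leafProj_eq hab ⟨ha, rfl⟩).2

theorem IsFlowInvariant.mem_of_isMIntegralCurveOn {A : Set W} (hA : IsFlowInvariant Δ A)
    {O : Set W} {X : ∀ n : W, TangentSpace 𝓘(ℝ, EW) n} {γ : ℝ → W} {s t : ℝ}
    (hX : IsLocalSection Δ O X) (hO : ∀ r ∈ uIcc s t, γ r ∈ O)
    (hγ : IsMIntegralCurveOn (I := 𝓘(ℝ, EW)) γ X (uIcc s t)) (hs : γ s ∈ A) {r : ℝ}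
    (hr : r ∈ uIcc s t) : γ r ∈ A := by
  have hsub : uIcc s r ⊆ uIcc s t := uIcc_subset_uIcc left_mem_uIcc hr
  exact hA (γ s) (γ r) ⟨O, X, γ, s, r, hX, fun q hq => hO q (hsub hq), hγ.mono hsub, rfl, rfl⟩ hs

end Distribution

variable {G : Type*} {Φ : G → P → P} {ι : W → P} {D : ∀ z : P, Submodule ℝ (TangentSpace I z)}

theorem IsBasicOn.eq_of_leafProj_eq (hι : MDifferentiable 𝓘(ℝ, EW) I ι) {U : Set P} {f : P → ℝ}
    (hf : IsBasicOn Φ ι D U f) (hU : IsFlowInvariant (restrictDist (EW := EW) ι D) (ι ⁻¹' U))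
    {a b : W} (hab : leafProj (restrictDist (EW := EW) ι D) a = leafProj (restrictDist ι D) b)
    (ha : ι a ∈ U) : f (ι b) = f (ι a) := by
  refine hU.eq_of_leafProj_eq (F := f ∘ ι) ?_ hab ha
  rintro _ _ ⟨O, X, γ, s, t, hX, hO, hγ, rfl, rfl⟩ hs
  have hderiv : ∀ r ∈ uIcc s t,
      HasMFDerivWithinAt 𝓘(ℝ, ℝ) 𝓘(ℝ, ℝ) ((f ∘ ι) ∘ γ) (uIcc s t) r 0 := fun r hr => by
    have hmem : ι (γ r) ∈ U := hU.mem_of_isMIntegralCurveOn hX hO hγ hs hr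
    have hfr := hf.mdifferentiableAt hmem
    refine hasMFDerivWithinAt_comp_zero_of_isMIntegralCurveOn hγ hr (hfr.comp _ (hι _)) ?_
    rw [mfderiv_comp _ hfr (hι _)]
    exact hf.kills _ trivial hmem _ (hX.2.2 _ (hO r hr))
  exact eq_of_hasMFDerivWithinAt_zero (fun r hr => (hderiv r hr).continuousWithinAt) isOpen_univ
    (mem_univ _) fun r hr _ => hderiv r hr

theorem isFlowInvariant_preimage_of_eq_bot [IsManifold I ∞ P]
    (hι : MDifferentiable 𝓘(ℝ, EW) I ι) {U : Set P} (hU : IsOpen U)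
    (hbot : ∀ n, ι n ∈ U → D (ι n) = ⊥) :
    IsFlowInvariant (restrictDist (EW := EW) ι D) (ι ⁻¹' U) := by
  have : IsManifold I 1 P := IsManifold.of_le (n := ∞) (by simp)
  rintro _ _ ⟨O, X, γ, s, t, hX, hO, hγ, rfl, rfl⟩ hs
  have hcont : ContinuousOn γ (uIcc s t) := fun r hr => (hγ r hr).continuousWithinAt
  have hderiv : ∀ r ∈ uIcc s t, ι (γ r) ∈ U →
      HasMFDerivWithinAt 𝓘(ℝ, ℝ) I (ι ∘ γ) (uIcc s t) r 0 := fun r hr hrU => by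
    refine hasMFDerivWithinAt_comp_zero_of_isMIntegralCurveOn hγ hr (hι _) ?_
    have hmem : mfderiv 𝓘(ℝ, EW) I ι (γ r) (X (γ r)) ∈ D (ι (γ r)) := hX.2.2 _ (hO r hr)
    rwa [hbot _ hrU, Submodule.mem_bot] at hmem
  have hfixed : ι (γ t) = ι (γ s) :=
    eq_of_hasMFDerivWithinAt_zero (hι.continuous.comp_continuousOn hcont) hU hs hderiv
  rwa [mem_preimage, hfixed]

end Leaves

section Extensions

variable {EP : Type*} [NormedAddCommGroup EP] [NormedSpace ℝ EP]
  {HP : Type*} [TopologicalSpace HP] {I : ModelWithCorners ℝ EP HP}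
  {P : Type*} [TopologicalSpace P] [ChartedSpace HP P]
  {EW : Type*} [NormedAddCommGroup EW] [NormedSpace ℝ EW]
  {W : Type*} [TopologicalSpace W] [ChartedSpace EW W] [IsManifold 𝓘(ℝ, EW) ∞ W]
  {G : Type*} {Φ : G → P → P} {ι : W → P} {D : ∀ z : P, Submodule ℝ (TangentSpace I z)}

/-! ### Basic extensions -/

variable (Φ ι D) in
/-- Local `D`-invariant extensions `K` of `k ∘ π` whose domain `U` meets `W` inside `π⁻¹(V)`. Then
`dK` vanishes on `D` along all of `U ∩ W`, so that the Poisson property of `D` applies to `K`. -/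
structure IsBasicExtension (V : Set (LeafSpace (restrictDist (EW := EW) ι D))) (k : V → ℝ)
    (U : Set P) (K : P → ℝ) : Prop where
  basic : IsBasicOn Φ ι D U K
  flow : IsFlowInvariant (restrictDist (EW := EW) ι D) (ι ⁻¹' U)
  subset : ι ⁻¹' U ⊆ leafProj (restrictDist ι D) ⁻¹' V
  eq : ∀ n (hn : ι n ∈ U), K (ι n) = k ⟨_, subset hn⟩

variable (Φ ι D) in
/-- Around every point of `π⁻¹(V)` the function `k ∘ π` has a basic extension. -/
def HasBasicExtensions (V : Set (LeafSpace (restrictDist (EW := EW) ι D))) (k : V → ℝ) : Prop :=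
  ∀ n, leafProj (restrictDist ι D) n ∈ V → ∃ U K, ι n ∈ U ∧ IsBasicExtension Φ ι D V k U K

variable (EW Φ ι D) in
/-- The preimages in `W` of open `G`-invariant sets of leaves are cut out by open `G`-invariant
sets of the ambient manifold. -/
def CutsOutInvOpens : Prop :=
  ∀ V : InvOpens (EW := EW) Φ ι D, ∃ O : Set P, IsOpen O ∧ IsGInvariantSet Φ O ∧
    ι ⁻¹' O = leafProj (restrictDist ι D) ⁻¹' V.1

theorem cutsOutInvOpens_of_isEmbedding [Group G] (hΦ : IsGroupAction Φ)
    (hcont : ∀ g, Continuous (Φ g)) (hι : Topology.IsEmbedding ι)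
    (hW : IsGInvariantSet Φ (range ι)) : CutsOutInvOpens EW Φ ι D := fun V =>
  exists_invariant_isOpen_preimage_eq hΦ hcont hι hW (isOpen_preimage_leafProj V.2.1) V.2.2

namespace IsBasicExtension

variable {V : Set (LeafSpace (restrictDist (EW := EW) ι D))} {k l : V → ℝ} {U U' : Set P}
  {K L : P → ℝ}

theorem isLocalInvariantExtension (hK : IsBasicExtension Φ ι D V k U K) :
    IsLocalInvariantExtension Φ ι D V k U K :=
  ⟨⟨hK.basic.toIsInvariantSmoothOn, hK.flow, fun n _ hn => hK.eq n hn⟩,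
    fun n _ => hK.basic.kills n trivial⟩

theorem inter_left (hK : IsBasicExtension Φ ι D V k U K) (hL : IsBasicExtension Φ ι D V l U' L) :
    IsBasicExtension Φ ι D V k (U ∩ U') K :=
  ⟨hK.basic.mono inter_subset_left (hK.basic.isOpen.inter hL.basic.isOpen)
    (hK.basic.invariant.inter hL.basic.invariant), hK.flow.inter hL.flow,
    fun _ hn => hK.subset hn.1, fun n hn => hK.eq n hn.1⟩

theorem inter_right (hK : IsBasicExtension Φ ι D V k U K) (hL : IsBasicExtension Φ ι D V l U' L) :
    IsBasicExtension Φ ι D V l (U ∩ U') L :=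
  inter_comm U' U ▸ hL.inter_left hK

theorem add (hK : IsBasicExtension Φ ι D V k U K) (hL : IsBasicExtension Φ ι D V l U L) :
    IsBasicExtension Φ ι D V (k + l) U (fun z => K z + L z) :=
  ⟨hK.basic.add hL.basic, hK.flow, hK.subset, fun n hn => congrArg₂ _ (hK.eq n hn) (hL.eq n hn)⟩

theorem mul (hK : IsBasicExtension Φ ι D V k U K) (hL : IsBasicExtension Φ ι D V l U L) :
    IsBasicExtension Φ ι D V (k * l) U (fun z => K z * L z) :=
  ⟨hK.basic.mul hL.basic, hK.flow, hK.subset, fun n hn => congrArg₂ _ (hK.eq n hn) (hL.eq n hn)⟩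

theorem smul (hK : IsBasicExtension Φ ι D V k U K) (c : ℝ) :
    IsBasicExtension Φ ι D V (c • k) U (fun z => c * K z) :=
  ⟨hK.basic.const_mul c, hK.flow, hK.subset, fun n hn => congrArg (c * ·) (hK.eq n hn)⟩

end IsBasicExtension

namespace HasBasicExtensions

variable {V : Set (LeafSpace (restrictDist (EW := EW) ι D))} {k l m : V → ℝ}

theorem exists_common (hk : HasBasicExtensions Φ ι D V k) (hl : HasBasicExtensions Φ ι D V l)
    {n : W} (hn : leafProj (restrictDist ι D) n ∈ V) :
    ∃ U K L, ι n ∈ U ∧ IsBasicExtension Φ ι D V k U K ∧ IsBasicExtension Φ ι D V l U L := by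
  obtain ⟨U, K, hU, hK⟩ := hk n hn
  obtain ⟨U', L, hU', hL⟩ := hl n hn
  exact ⟨U ∩ U', K, L, ⟨hU, hU'⟩, hK.inter_left hL, hK.inter_right hL⟩

theorem exists_common₃ (hk : HasBasicExtensions Φ ι D V k) (hl : HasBasicExtensions Φ ι D V l)
    (hm : HasBasicExtensions Φ ι D V m) {n : W} (hn : leafProj (restrictDist ι D) n ∈ V) :
    ∃ U K L M, ι n ∈ U ∧ IsBasicExtension Φ ι D V k U K ∧ IsBasicExtension Φ ι D V l U L ∧
      IsBasicExtension Φ ι D V m U M := by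
  obtain ⟨U, K, L, hU, hK, hL⟩ := hk.exists_common hl hn
  obtain ⟨U', M, hU', hM⟩ := hm n hn
  exact ⟨U ∩ U', K, L, M, ⟨hU, hU'⟩, hK.inter_left hM, hL.inter_left hM, hK.inter_right hM⟩

end HasBasicExtensions

theorem CutsOutInvOpens.exists_isBasicExtension (hO : CutsOutInvOpens EW Φ ι D)
    {V : InvOpens (EW := EW) Φ ι D} {k : V.1 → ℝ} {U : Set P} {K : P → ℝ}
    (hK : IsLocalInvariantExtension Φ ι D V.1 k U K) {n : W}
    (hn : leafProj (restrictDist ι D) n ∈ V.1) (hU : ι n ∈ U) :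
    ∃ U', ι n ∈ U' ∧ IsBasicExtension Φ ι D V.1 k U' K := by
  obtain ⟨O, hOopen, hOinv, hOV⟩ := hO V
  have hsub : ι ⁻¹' (U ∩ O) ⊆ leafProj (restrictDist ι D) ⁻¹' V.1 := fun m hm => hOV.le hm.2
  have hflow : IsFlowInvariant (restrictDist (EW := EW) ι D) (ι ⁻¹' O) := by
    rw [hOV]
    exact isFlowInvariant_preimage_leafProj V.1
  exact ⟨U ∩ O, ⟨hU, hOV.ge hn⟩, ⟨hK.1.inv.mono inter_subset_left (hK.1.inv.isOpen.inter hOopen)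
    (hK.1.inv.invariant.inter hOinv), fun m _ hm => hK.2 m (hsub hm) hm.1⟩,
    hK.1.flow.inter hflow, hsub, fun m hm => hK.1.eq m (hsub hm) hm.1⟩

theorem IsLocalInvariantExtension.restrict
    {V V' : Set (LeafSpace (restrictDist (EW := EW) ι D))} {k : V → ℝ} {U : Set P} {K : P → ℝ}
    (hK : IsLocalInvariantExtension Φ ι D V k U K) (h : V' ⊆ V) :
    IsLocalInvariantExtension Φ ι D V' (k ∘ inclusion h) U K :=
  ⟨⟨hK.1.inv, hK.1.flow, fun n hn => hK.1.eq n (h hn)⟩, fun n hn => hK.2 n (h hn)⟩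

theorem HasLocalExtensionProperty.hasBasicExtensions
    (hext : HasLocalExtensionProperty (EW := EW) Φ ι D) (hO : CutsOutInvOpens EW Φ ι D)
    (V : InvOpens (EW := EW) Φ ι D) (k : leafFunctions Φ ι D V.1) :
    HasBasicExtensions Φ ι D V.1 k.1 := fun n hn => by
  obtain ⟨m, hmn, U, K, hmU, hK⟩ := hext V k _ hn
  obtain ⟨U', hU', hKU'⟩ :=
    hO.exists_isBasicExtension hK hn (hK.1.flow.mem_of_leafProj_eq hmn hmU)
  exact ⟨U', K, hU', hKU'⟩

theorem HasBasicExtensions.mem_leafFunctions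
    {V : Set (LeafSpace (restrictDist (EW := EW) ι D))} {k : V → ℝ}
    (hk : HasBasicExtensions Φ ι D V k) : k ∈ leafFunctions Φ ι D V := fun x hx => by
  obtain ⟨n, rfl⟩ := leafProj_surjective x
  obtain ⟨U, K, hU, hK⟩ := hk n hx
  exact ⟨n, rfl, U, K, hU, hK.isLocalInvariantExtension.1⟩

theorem funext_leafProj {V : Set (LeafSpace (restrictDist (EW := EW) ι D))} {k l : V → ℝ}
    (h : ∀ n (hn : leafProj (restrictDist ι D) n ∈ V), k ⟨_, hn⟩ = l ⟨_, hn⟩) : k = l := by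
  ext ⟨x, hx⟩
  obtain ⟨n, rfl⟩ := leafProj_surjective x
  exact h n hx

end Extensions

section Commutation

variable {EP : Type*} [NormedAddCommGroup EP] [NormedSpace ℝ EP]
  {HP : Type*} [TopologicalSpace HP] {I : ModelWithCorners ℝ EP HP}
  {P : Type*} [TopologicalSpace P] [ChartedSpace HP P]
  {W G : Type*} {B : PoissonStructure I P} {Φ : G → P → P} {ι : W → P}
  {D : ∀ z : P, Submodule ℝ (TangentSpace I z)}

/-! ### The annihilator condition -/

variable (B Φ ι D) in
/-- At `z`, basic functions that vanish on `W` Poisson-commute with all basic functions. -/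
def VanishingBasicCommuteAt (z : P) : Prop :=
  ∀ U f g, z ∈ U → IsBasicOn Φ ι D U f → IsBasicOn Φ ι D U g → (∀ n, ι n ∈ U → g (ι n) = 0) →
    B.bracket g f z = 0

theorem sharp_image_invCodist_subset_iff {z : P} :
    B.sharp z '' invCodist Φ ι D z ⊆ annihilatorOf (invCodistConst Φ ι D z) ↔
      VanishingBasicCommuteAt B Φ ι D z := by
  constructor
  · intro h U f g hz hf hg hg0
    exact h ⟨_, ⟨U, f, hz, hf.toIsInvariantSmoothOn, hf.kills, rfl⟩, rfl⟩ _
      ⟨U, g, hz, hg.toIsInvariantSmoothOn, hg.kills, ⟨0, hg0⟩, rfl⟩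
  · rintro h _ ⟨_, ⟨U, f, hzU, hf, hfk, rfl⟩, rfl⟩ _ ⟨U', g, hzU', hg, hgk, ⟨c, hc⟩, rfl⟩
    have hopen := hf.isOpen.inter hg.isOpen
    have hinv := hf.invariant.inter hg.invariant
    have hfb : IsBasicOn Φ ι D (U ∩ U') f := .mono ⟨hf, hfk⟩ inter_subset_left hopen hinv
    have hgb : IsBasicOn Φ ι D (U ∩ U') g := .mono ⟨hg, hgk⟩ inter_subset_right hopen hinv
    have hvanish := h (U ∩ U') f (fun y => g y + -c) ⟨hzU, hzU'⟩ hfb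
      (hgb.add (.const hopen hinv (-c))) fun n hn => by rw [hc n hn.2, add_neg_cancel]
    rwa [B.bracket_add_left f (hg.mdifferentiableAt hzU') mdifferentiableAt_const,
      B.bracket_const_left, add_zero] at hvanish

end Commutation

section Sufficiency

variable {EP : Type*} [NormedAddCommGroup EP] [NormedSpace ℝ EP]
  {HP : Type*} [TopologicalSpace HP] {I : ModelWithCorners ℝ EP HP}
  {P : Type*} [TopologicalSpace P] [ChartedSpace HP P]
  {EW : Type*} [NormedAddCommGroup EW] [NormedSpace ℝ EW]
  {W : Type*} [TopologicalSpace W] [ChartedSpace EW W] [IsManifold 𝓘(ℝ, EW) ∞ W]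
  {G : Type*} {B : PoissonStructure I P} {Φ : G → P → P} {ι : W → P}
  {D : ∀ z : P, Submodule ℝ (TangentSpace I z)}

/-! ### The reduced bracket -/

namespace VanishingBasicCommuteAt

variable {V : Set (LeafSpace (restrictDist (EW := EW) ι D))} {k l : V → ℝ} {U U' : Set P}
  {K K' L L' : P → ℝ} {n : W}

theorem bracket_congr_left (hB : VanishingBasicCommuteAt B Φ ι D (ι n)) (hn : ι n ∈ U)
    (hK : IsBasicExtension Φ ι D V k U K) (hK' : IsBasicExtension Φ ι D V k U K')
    (hL : IsBasicOn Φ ι D U L) : B.bracket K L (ι n) = B.bracket K' L (ι n) := by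
  have hdiff := hB U L (fun z => K z + -1 * K' z) hn hL (hK.basic.add (hK'.basic.const_mul (-1)))
    fun m hm => by rw [hK.eq m hm, hK'.eq m hm, neg_one_mul, add_neg_cancel]
  rw [B.bracket_add_left L (hK.basic.mdifferentiableAt hn)
    ((hK'.basic.const_mul (-1)).mdifferentiableAt hn),
    B.bracket_const_mul_left (-1) L (hK'.basic.mdifferentiableAt hn)] at hdiff
  linarith

theorem bracket_congr (hB : VanishingBasicCommuteAt B Φ ι D (ι n)) (hn : ι n ∈ U)
    (hn' : ι n ∈ U') (hK : IsBasicExtension Φ ι D V k U K) (hL : IsBasicExtension Φ ι D V l U L)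
    (hK' : IsBasicExtension Φ ι D V k U' K') (hL' : IsBasicExtension Φ ι D V l U' L') :
    B.bracket K L (ι n) = B.bracket K' L' (ι n) := by
  have hmem : ι n ∈ U ∩ U' := ⟨hn, hn'⟩
  have hK'U : IsBasicExtension Φ ι D V k (U ∩ U') K' := hK.inter_right hK'
  have hL'U : IsBasicExtension Φ ι D V l (U ∩ U') L' := hL.inter_right hL'
  calc B.bracket K L (ι n)
      = B.bracket K' L (ι n) :=
        hB.bracket_congr_left hmem (hK.inter_left hK') hK'U (hL.inter_left hK').basic
    _ = -B.bracket L K' (ι n) := B.bracket_skew _ _ _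
    _ = -B.bracket L' K' (ι n) := by
        rw [hB.bracket_congr_left hmem (hL.inter_left hK') hL'U hK'U.basic]
    _ = B.bracket K' L' (ι n) := (B.bracket_skew _ _ _).symm

end VanishingBasicCommuteAt

variable (B Φ) in
/-- `b` is a reduced bracket of `k` and `l`: it is computed by the bracket of any two local
`D`-invariant extensions of `k ∘ π` and `l ∘ π`. -/
def IsReducedBracket (V : Set (LeafSpace (restrictDist (EW := EW) ι D))) (k l b : V → ℝ) : Prop :=
  ∀ (n : W) (hn : leafProj (restrictDist ι D) n ∈ V) (U : Set P) (K L : P → ℝ), ι n ∈ U →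
    IsLocalInvariantExtension Φ ι D V k U K → IsLocalInvariantExtension Φ ι D V l U L →
    b ⟨_, hn⟩ = B.bracket K L (ι n)

theorem exists_isReducedBracket (hΦ : ∀ g, B.IsPoissonMap (Φ g))
    (hι : MDifferentiable 𝓘(ℝ, EW) I ι) (hD : IsPoissonDistribution B ι D)
    (hO : CutsOutInvOpens EW Φ ι D) (hB : ∀ n, VanishingBasicCommuteAt B Φ ι D (ι n))
    {V : InvOpens (EW := EW) Φ ι D} {k l : V.1 → ℝ} (hk : HasBasicExtensions Φ ι D V.1 k)
    (hl : HasBasicExtensions Φ ι D V.1 l) : ∃ b, IsReducedBracket B Φ V.1 k l b := by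
  choose rep hrep using fun x : V.1 => leafProj_surjective x.1
  choose U K L hU hK hL using fun x : V.1 =>
    hk.exists_common hl (n := rep x) (Set.mem_of_eq_of_mem (hrep x) x.2)
  refine ⟨fun x => B.bracket (K x) (L x) (ι (rep x)), fun n hn U' K' L' hU' hK' hL' => ?_⟩
  set x : V.1 := ⟨_, hn⟩
  have hnU : ι n ∈ U x := (hK x).flow.mem_of_leafProj_eq (hrep x) (hU x)
  obtain ⟨UK, hnUK, hKb⟩ := hO.exists_isBasicExtension hK' hn hU'
  obtain ⟨UL, hnUL, hLb⟩ := hO.exists_isBasicExtension hL' hn hU'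
  calc B.bracket (K x) (L x) (ι (rep x))
      = B.bracket (K x) (L x) (ι n) :=
        (((hK x).basic.bracket hΦ hD (hL x).basic).eq_of_leafProj_eq hι (hK x).flow (hrep x)
          (hU x)).symm
    _ = B.bracket K' L' (ι n) :=
        (hB n).bracket_congr hnU (mem_inter hnUK hnUL) (hK x) (hL x) (hKb.inter_left hLb)
          (hKb.inter_right hLb)

namespace IsReducedBracket

variable {V : Set (LeafSpace (restrictDist (EW := EW) ι D))} {k k' l l' m b b' c : V → ℝ}
  {U : Set P} {K L : P → ℝ}

theorem apply_eq (hb : IsReducedBracket B Φ V k l b) (hK : IsBasicExtension Φ ι D V k U K)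
    (hL : IsBasicExtension Φ ι D V l U L) {n : W} (hn : ι n ∈ U) :
    b ⟨_, hK.subset hn⟩ = B.bracket K L (ι n) :=
  hb n _ U K L hn hK.isLocalInvariantExtension hL.isLocalInvariantExtension

theorem isBasicExtension (hΦ : ∀ g, B.IsPoissonMap (Φ g)) (hD : IsPoissonDistribution B ι D)
    (hb : IsReducedBracket B Φ V k l b) (hK : IsBasicExtension Φ ι D V k U K)
    (hL : IsBasicExtension Φ ι D V l U L) : IsBasicExtension Φ ι D V b U (B.bracket K L) :=
  ⟨hK.basic.bracket hΦ hD hL.basic, hK.flow, hK.subset, fun _ hn => (hb.apply_eq hK hL hn).symm⟩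

theorem hasBasicExtensions (hΦ : ∀ g, B.IsPoissonMap (Φ g)) (hD : IsPoissonDistribution B ι D)
    (hk : HasBasicExtensions Φ ι D V k) (hl : HasBasicExtensions Φ ι D V l)
    (hb : IsReducedBracket B Φ V k l b) : HasBasicExtensions Φ ι D V b := fun n hn => by
  obtain ⟨U, K, L, hU, hK, hL⟩ := hk.exists_common hl hn
  exact ⟨U, B.bracket K L, hU, hb.isBasicExtension hΦ hD hK hL⟩

theorem swap (hb : IsReducedBracket B Φ V k l b) : IsReducedBracket B Φ V l k (-b) :=
  fun n hn U K L hU hK hL => by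
    rw [Pi.neg_apply, hb n hn U L K hU hL hK, B.bracket_skew, neg_neg]

theorem unique (hk : HasBasicExtensions Φ ι D V k) (hl : HasBasicExtensions Φ ι D V l)
    (hb : IsReducedBracket B Φ V k l b) (hb' : IsReducedBracket B Φ V k l b') : b = b' :=
  funext_leafProj fun n hn => by
    obtain ⟨U, K, L, hU, hK, hL⟩ := hk.exists_common hl hn
    rw [hb.apply_eq hK hL hU, hb'.apply_eq hK hL hU]

theorem add_left (hk : HasBasicExtensions Φ ι D V k) (hk' : HasBasicExtensions Φ ι D V k')
    (hl : HasBasicExtensions Φ ι D V l) (hb : IsReducedBracket B Φ V k l b)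
    (hb' : IsReducedBracket B Φ V k' l b') (hc : IsReducedBracket B Φ V (k + k') l c) :
    c = b + b' :=
  funext_leafProj fun n hn => by
    obtain ⟨U, K, K', L, hU, hK, hK', hL⟩ := hk.exists_common₃ hk' hl hn
    rw [Pi.add_apply, hc.apply_eq (hK.add hK') hL hU, hb.apply_eq hK hL hU, hb'.apply_eq hK' hL hU,
      B.bracket_add_left L (hK.basic.mdifferentiableAt hU) (hK'.basic.mdifferentiableAt hU)]

theorem smul_left (hk : HasBasicExtensions Φ ι D V k) (hl : HasBasicExtensions Φ ι D V l) {r : ℝ}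
    (hb : IsReducedBracket B Φ V k l b) (hc : IsReducedBracket B Φ V (r • k) l c) : c = r • b :=
  funext_leafProj fun n hn => by
    obtain ⟨U, K, L, hU, hK, hL⟩ := hk.exists_common hl hn
    rw [Pi.smul_apply, hc.apply_eq (hK.smul r) hL hU, hb.apply_eq hK hL hU,
      B.bracket_const_mul_left r L (hK.basic.mdifferentiableAt hU), smul_eq_mul]

theorem leibniz (hk : HasBasicExtensions Φ ι D V k) (hl : HasBasicExtensions Φ ι D V l)
    (hm : HasBasicExtensions Φ ι D V m) (hb : IsReducedBracket B Φ V k l b)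
    (hb' : IsReducedBracket B Φ V k m b') (hc : IsReducedBracket B Φ V k (l * m) c) :
    c = b * m + l * b' :=
  funext_leafProj fun n hn => by
    obtain ⟨U, K, L, M, hU, hK, hL, hM⟩ := hk.exists_common₃ hl hm hn
    rw [Pi.add_apply, Pi.mul_apply, Pi.mul_apply, hc.apply_eq hK (hL.mul hM) hU,
      hb.apply_eq hK hL hU, hb'.apply_eq hK hM hU, ← hL.eq n hU, ← hM.eq n hU,
      B.bracket_mul_right K (hL.basic.mdifferentiableAt hU) (hM.basic.mdifferentiableAt hU)]
    ring

theorem jacobi (hΦ : ∀ g, B.IsPoissonMap (Φ g)) (hD : IsPoissonDistribution B ι D)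
    (hk : HasBasicExtensions Φ ι D V k) (hl : HasBasicExtensions Φ ι D V l)
    (hm : HasBasicExtensions Φ ι D V m) {kl lm mk a₁ a₂ a₃ : V → ℝ}
    (hkl : IsReducedBracket B Φ V k l kl) (hlm : IsReducedBracket B Φ V l m lm)
    (hmk : IsReducedBracket B Φ V m k mk) (h₁ : IsReducedBracket B Φ V k lm a₁)
    (h₂ : IsReducedBracket B Φ V l mk a₂) (h₃ : IsReducedBracket B Φ V m kl a₃) :
    a₁ + a₂ + a₃ = 0 :=
  funext_leafProj fun n hn => by
    obtain ⟨U, K, L, M, hU, hK, hL, hM⟩ := hk.exists_common₃ hl hm hn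
    rw [Pi.add_apply, Pi.add_apply, h₁.apply_eq hK (hlm.isBasicExtension hΦ hD hL hM) hU,
      h₂.apply_eq hL (hmk.isBasicExtension hΦ hD hM hK) hU,
      h₃.apply_eq hM (hkl.isBasicExtension hΦ hD hK hL) hU]
    exact B.jacobi U hK.basic.isOpen K L M hK.basic.smooth hL.basic.smooth hM.basic.smooth _ hU

theorem add_right (hk : HasBasicExtensions Φ ι D V k) (hl : HasBasicExtensions Φ ι D V l)
    (hl' : HasBasicExtensions Φ ι D V l') (hb : IsReducedBracket B Φ V k l b)
    (hb' : IsReducedBracket B Φ V k l' b') (hc : IsReducedBracket B Φ V k (l + l') c) :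
    c = b + b' :=
  neg_injective <| (hb.swap.add_left hl hl' hk hb'.swap hc.swap).trans (neg_add b b').symm

theorem smul_right (hk : HasBasicExtensions Φ ι D V k) (hl : HasBasicExtensions Φ ι D V l) {r : ℝ}
    (hb : IsReducedBracket B Φ V k l b) (hc : IsReducedBracket B Φ V k (r • l) c) : c = r • b :=
  neg_injective <| (hb.swap.smul_left hl hk hc.swap).trans (smul_neg r b)

theorem comp_inclusion (hk : HasBasicExtensions Φ ι D V k) (hl : HasBasicExtensions Φ ι D V l)
    (hb : IsReducedBracket B Φ V k l b) {V' : Set (LeafSpace (restrictDist (EW := EW) ι D))}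
    (h : V' ⊆ V) {b' : V' → ℝ}
    (hb' : IsReducedBracket B Φ V' (k ∘ inclusion h) (l ∘ inclusion h) b') :
    b ∘ inclusion h = b' :=
  funext_leafProj fun n hn => by
    obtain ⟨U, K, L, hU, hK, hL⟩ := hk.exists_common hl (h hn)
    exact (hb.apply_eq hK hL hU).trans (hb' n hn U K L hU (hK.isLocalInvariantExtension.restrict h)
      (hL.isLocalInvariantExtension.restrict h)).symm

end IsReducedBracket

theorem isPoissonReducible_of_vanishingBasicCommuteAt (hΦ : ∀ g, B.IsPoissonMap (Φ g))
    (hι : MDifferentiable 𝓘(ℝ, EW) I ι) (hD : IsPoissonDistribution B ι D)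
    (hO : CutsOutInvOpens EW Φ ι D) (hext : HasLocalExtensionProperty (EW := EW) Φ ι D)
    (hB : ∀ n, VanishingBasicCommuteAt B Φ ι D (ι n)) :
    IsPoissonReducible (EW := EW) B Φ ι D := by
  have hbasic := hext.hasBasicExtensions hO
  choose b hb using fun (V : InvOpens (EW := EW) Φ ι D) (k l : leafFunctions Φ ι D V.1) =>
    exists_isReducedBracket hΦ hι hD hO hB (hbasic V k) (hbasic V l)
  let br (V : InvOpens (EW := EW) Φ ι D) (k l : leafFunctions Φ ι D V.1) :
      leafFunctions Φ ι D V.1 :=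
    ⟨b V k l, ((hb V k l).hasBasicExtensions hΦ hD (hbasic V k) (hbasic V l)).mem_leafFunctions⟩
  refine ⟨fun V => LinearMap.mk₂ ℝ (br V)
    (fun k k' l => Subtype.ext ?add_left) (fun r k l => Subtype.ext ?smul_left)
    (fun k l l' => Subtype.ext ?add_right) (fun r k l => Subtype.ext ?smul_right),
    fun V k l => Subtype.ext ?skew, fun V k l m => Subtype.ext ?jacobi,
    fun V k l m => Subtype.ext ?leibniz, fun V V' h k l => Subtype.ext ?restrict, hb⟩
  case add_left =>
    exact (hb V k l).add_left (hbasic V k) (hbasic V k') (hbasic V l) (hb V k' l) (hb V (k + k') l)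
  case smul_left => exact (hb V k l).smul_left (hbasic V k) (hbasic V l) (hb V (r • k) l)
  case add_right =>
    exact (hb V k l).add_right (hbasic V k) (hbasic V l) (hbasic V l') (hb V k l') (hb V k (l + l'))
  case smul_right => exact (hb V k l).smul_right (hbasic V k) (hbasic V l) (hb V k (r • l))
  case skew => exact (hb V k l).unique (hbasic V k) (hbasic V l) (hb V l k).swap
  case jacobi =>
    exact IsReducedBracket.jacobi hΦ hD (hbasic V k) (hbasic V l) (hbasic V m) (hb V k l)
      (hb V l m) (hb V m k) (hb V k (br V l m)) (hb V l (br V m k)) (hb V m (br V k l))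
  case leibniz =>
    exact (hb V k l).leibniz (hbasic V k) (hbasic V l) (hbasic V m) (hb V k m) (hb V k (l * m))
  case restrict =>
    exact (hb V k l).comp_inclusion (hbasic V k) (hbasic V l) h
      (hb V' (leafRestrict Φ ι D h k) (leafRestrict Φ ι D h l))

end Sufficiency

section Necessity

variable {EP : Type*} [NormedAddCommGroup EP] [NormedSpace ℝ EP]
  {HP : Type*} [TopologicalSpace HP] {I : ModelWithCorners ℝ EP HP}
  {P : Type*} [TopologicalSpace P] [ChartedSpace HP P]
  {EW : Type*} [NormedAddCommGroup EW] [NormedSpace ℝ EW]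
  {W : Type*} {G : Type*} {B : PoissonStructure I P} {Φ : G → P → P} {ι : W → P}
  {D : ∀ z : P, Submodule ℝ (TangentSpace I z)} {U : Set P} {f g : P → ℝ}

/-! ### Necessity of the annihilator condition -/

theorem IsPoissonDistribution.dAt_mul_bracket_eq_zero (hD : IsPoissonDistribution B ι D)
    (hU : IsOpen U) {h : P → ℝ} (hf : ContMDiffOn I 𝓘(ℝ, ℝ) ∞ f U)
    (hg : ContMDiffOn I 𝓘(ℝ, ℝ) ∞ g U) (hh : ContMDiffOn I 𝓘(ℝ, ℝ) ∞ h U)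
    (hfD : KillsOn ι D f univ U) (hgD : KillsOn ι D g univ U) (hg0 : ∀ n, ι n ∈ U → g (ι n) = 0)
    {n : W} (hn : ι n ∈ U) {v : TangentSpace I (ι n)} (hv : v ∈ D (ι n)) :
    dAt I h (ι n) v * B.bracket g f (ι n) = 0 := by
  have hdiff {φ : P → ℝ} (hφ : ContMDiffOn I 𝓘(ℝ, ℝ) ∞ φ U) {z : P} (hz : z ∈ U) :
      MDifferentiableAt I 𝓘(ℝ, ℝ) φ z := mdifferentiableAt_of_contMDiffOn hφ hU hz
  have hgf : ContMDiffOn I 𝓘(ℝ, ℝ) ∞ (B.bracket g f) U := B.smooth U hU g f hg hf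
  have hhf : ContMDiffOn I 𝓘(ℝ, ℝ) ∞ (B.bracket h f) U := B.smooth U hU h f hh hf
  have hhgD : KillsOn ι D (fun z => h z * g z) univ U := fun m _ hm w hw => by
    rw [dAt_mul (hdiff hh hm) (hdiff hg hm), add_apply, smul_apply, smul_apply,
      hgD m trivial hm w hw, hg0 m hm, smul_zero, zero_smul, add_zero]
  have hleibniz : EqOn (B.bracket (fun z => h z * g z) f)
      (fun z => h z * B.bracket g f z + g z * B.bracket h f z) U := fun z hz =>
    B.bracket_mul_left f (hdiff hh hz) (hdiff hg hz)
  have hzero := hD U (fun z => h z * g z) f hU (hh.mul hg) hf hhgD hfD n trivial hn v hv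
  rw [dAt_congr_of_isOpen hU hleibniz hn,
    dAt_add (f := fun z => h z * B.bracket g f z) (g := fun z => g z * B.bracket h f z)
      (hdiff (hh.mul hgf) hn) (hdiff (hg.mul hhf) hn),
    dAt_mul (hdiff hh hn) (hdiff hgf hn), dAt_mul (hdiff hg hn) (hdiff hhf hn)] at hzero
  simp only [add_apply, smul_apply, smul_eq_mul, hg0 n hn, hgD n trivial hn v hv,
    hD U g f hU hg hf hgD hfD n trivial hn v hv] at hzero
  linarith

theorem IsPoissonDistribution.bracket_eq_zero_of_ne_bot [IsManifold I ∞ P]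
    (hD : IsPoissonDistribution B ι D) (hU : IsOpen U) (hf : ContMDiffOn I 𝓘(ℝ, ℝ) ∞ f U)
    (hg : ContMDiffOn I 𝓘(ℝ, ℝ) ∞ g U) (hfD : KillsOn ι D f univ U) (hgD : KillsOn ι D g univ U)
    (hg0 : ∀ n, ι n ∈ U → g (ι n) = 0) {n : W} (hn : ι n ∈ U) (hne : D (ι n) ≠ ⊥) :
    B.bracket g f (ι n) = 0 := by
  obtain ⟨v, hv, hv0⟩ := Submodule.exists_mem_ne_zero_of_ne_bot hne
  obtain ⟨O, h, hO, hnO, hh, hhv⟩ := exists_dAt_ne_zero hv0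
  have hmul := hD.dAt_mul_bracket_eq_zero (hU.inter hO) (hf.mono inter_subset_left)
    (hg.mono inter_subset_left) (hh.mono inter_subset_right) (fun m hm hmU => hfD m hm hmU.1)
    (fun m hm hmU => hgD m hm hmU.1) (fun m hm => hg0 m hm.1) ⟨hn, hnO⟩ hv
  exact (mul_eq_zero.1 hmul).resolve_left hhv

theorem IsGInvariantDistribution.eq_bot_of_mem_gSaturation [Group G] (hΦ : IsGroupAction Φ)
    (hW : IsGInvariantSet Φ (range ι)) (hDG : IsGInvariantDistribution Φ ι D) {O : Set P}
    (hO : ∀ n, ι n ∈ O → D (ι n) = ⊥) {n : W} (hn : ι n ∈ gSaturation Φ O) : D (ι n) = ⊥ := by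
  obtain ⟨γ, hγ⟩ := mem_gSaturation.1 hn
  obtain ⟨m, hm⟩ := hW γ _ (mem_range_self n)
  have hinv := hDG γ⁻¹ m
  rw [hO m (hm ▸ hγ), Submodule.map_bot, hm, hΦ.inv_apply_apply] at hinv
  exact hinv.symm

variable [TopologicalSpace W] [ChartedSpace EW W] [IsManifold 𝓘(ℝ, EW) ∞ W]

theorem exists_invOpens_preimage_eq (hι : Continuous ι) (hW : IsGInvariantSet Φ (range ι))
    (hU : IsOpen U) (hUinv : IsGInvariantSet Φ U)
    (hflow : IsFlowInvariant (restrictDist (EW := EW) ι D) (ι ⁻¹' U)) :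
    ∃ V : InvOpens (EW := EW) Φ ι D, leafProj (restrictDist ι D) ⁻¹' V.1 = ι ⁻¹' U := by
  have hV := hflow.preimage_image_leafProj
  refine ⟨⟨leafProj _ '' (ι ⁻¹' U), isOpen_coinduced.2 ?_, ?_⟩, hV⟩
  · change IsOpen (leafProj (restrictDist ι D) ⁻¹' _)
    rw [hV]
    exact hU.preimage hι
  · rw [hV, image_preimage_eq_inter_range]
    exact hUinv.inter hW

theorem IsBasicOn.exists_isBasicExtension (hι : MDifferentiable 𝓘(ℝ, EW) I ι)
    (hf : IsBasicOn Φ ι D U f) (hflow : IsFlowInvariant (restrictDist (EW := EW) ι D) (ι ⁻¹' U))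
    {V : Set (LeafSpace (restrictDist (EW := EW) ι D))}
    (hV : leafProj (restrictDist ι D) ⁻¹' V = ι ⁻¹' U) :
    ∃ k : leafFunctions Φ ι D V, IsBasicExtension Φ ι D V k.1 U f := by
  choose rep hrep using fun x : V => leafProj_surjective x.1
  have hrepU (x : V) : ι (rep x) ∈ U := hV.le (show leafProj _ (rep x) ∈ V from (hrep x).symm ▸ x.2)
  have hk : IsBasicExtension Φ ι D V (fun x => f (ι (rep x))) U f :=
    ⟨hf, hflow, hV.ge, fun n hn => hf.eq_of_leafProj_eq hι hflow (hrep _) (hrepU ⟨_, hV.ge hn⟩)⟩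
  have hbasic : HasBasicExtensions Φ ι D V fun x => f (ι (rep x)) :=
    fun n hn => ⟨U, f, hV.le hn, hk⟩
  exact ⟨⟨_, hbasic.mem_leafFunctions⟩, hk⟩

theorem IsPoissonReducible.bracket_eq_zero (hred : IsPoissonReducible (EW := EW) B Φ ι D)
    (hι : MDifferentiable 𝓘(ℝ, EW) I ι) (hW : IsGInvariantSet Φ (range ι))
    (hflow : IsFlowInvariant (restrictDist (EW := EW) ι D) (ι ⁻¹' U)) (hf : IsBasicOn Φ ι D U f)
    (hg : IsBasicOn Φ ι D U g) (hg0 : ∀ n, ι n ∈ U → g (ι n) = 0) {n : W} (hn : ι n ∈ U) :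
    B.bracket g f (ι n) = 0 := by
  obtain ⟨V, hV⟩ := exists_invOpens_preimage_eq hι.continuous hW hf.isOpen hf.invariant hflow
  obtain ⟨l, hl⟩ := hf.exists_isBasicExtension hι hflow hV
  obtain ⟨k, hk⟩ := hg.exists_isBasicExtension hι hflow hV
  have hk0 : IsBasicExtension Φ ι D V.1 k.1 U fun _ => 0 :=
    ⟨.const hf.isOpen hf.invariant 0, hflow, hk.subset,
      fun m hm => (hg0 m hm).symm.trans (hk.eq m hm)⟩
  obtain ⟨br, -, -, -, -, hbr⟩ := hred
  have hred : IsReducedBracket B Φ V.1 k.1 l.1 (br V k l).1 := hbr V k l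
  rw [← hred.apply_eq hk hl hn, hred.apply_eq hk0 hl hn, B.bracket_const_left]

theorem IsPoissonReducible.vanishingBasicCommuteAt [IsManifold I ∞ P] [Group G]
    (hred : IsPoissonReducible (EW := EW) B Φ ι D) (hΦ : IsGroupAction Φ)
    (hcont : ∀ g, Continuous (Φ g)) (hemb : Topology.IsEmbedding ι)
    (hι : MDifferentiable 𝓘(ℝ, EW) I ι) (hW : IsGInvariantSet Φ (range ι))
    (hD : IsPoissonDistribution B ι D) (hDG : IsGInvariantDistribution Φ ι D) (n : W) :
    VanishingBasicCommuteAt B Φ ι D (ι n) := by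
  intro U f g hn hf hg hg0
  by_cases hbot : ∀ᶠ m in 𝓝 n, D (ι m) = ⊥
  · rw [hemb.isInducing.nhds_eq_comap] at hbot
    obtain ⟨O', hO', hO'bot⟩ := hbot
    obtain ⟨O, hOO', hO, hnO⟩ := mem_nhds_iff.1 hO'
    have hopen := hf.isOpen.inter (isOpen_gSaturation hcont hO)
    have hinv := hf.invariant.inter (isGInvariantSet_gSaturation (O := O) hΦ)
    have hflow := isFlowInvariant_preimage_of_eq_bot hι hopen fun m hm =>
      hDG.eq_bot_of_mem_gSaturation hΦ hW (fun _ hp => hO'bot (hOO' hp)) hm.2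
    exact hred.bracket_eq_zero hι hW hflow (hf.mono inter_subset_left hopen hinv)
      (hg.mono inter_subset_left hopen hinv) (fun m hm => hg0 m hm.1)
      ⟨hn, subset_gSaturation hΦ hnO⟩
  · have hU : ∀ᶠ m in 𝓝 n, ι m ∈ U :=
      hι.continuous.continuousAt.eventually_mem (hf.isOpen.mem_nhds hn)
    have hzero : ∃ᶠ m in 𝓝 n, B.bracket g f (ι m) = 0 :=
      ((Filter.not_eventually.1 hbot).and_eventually hU).mono fun m hm =>
        hD.bracket_eq_zero_of_ne_bot hf.isOpen hf.smooth hg.smooth hf.kills hg.kills hg0 hm.2 hm.1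
    have hlim : Filter.Tendsto (fun m => B.bracket g f (ι m)) (𝓝 n) (𝓝 (B.bracket g f (ι n))) :=
      ((B.smooth U hf.isOpen g f hg.smooth hf.smooth).continuousOn.continuousAt
        (hf.isOpen.mem_nhds hn)).comp hι.continuous.continuousAt
    exact isClosed_singleton.mem_of_frequently_of_tendsto hzero hlim

end Necessity

section Cotangent

variable {E : Type*} [NormedAddCommGroup E] [NormedSpace ℝ E]
  {Q : Type*} [TopologicalSpace Q] [ChartedSpace E Q]

/-! ### The cotangent lifted action -/

theorem cotangentBundle_ext {x y : Q} (h : x = y) {A A' : E →L[ℝ] ℝ} (hA : A = A') :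
    (⟨x, A⟩ : CotangentBundle E Q) = ⟨y, A'⟩ := by
  subst h hA
  rfl

variable {G : Type*} [Group G] [MulAction G Q]

variable (E) in
/-- The derivative of the action of `g` at `q`, as an endomorphism of the model space. -/
noncomputable def smulDeriv (g : G) (q : Q) : E →L[ℝ] E :=
  mfderiv 𝓘(ℝ, E) 𝓘(ℝ, E) (fun q : Q => g • q) q

theorem smulDeriv_one (q : Q) : smulDeriv E (1 : G) q = ContinuousLinearMap.id ℝ E := by
  have h : (fun q : Q => (1 : G) • q) = id := funext fun q => one_smul G q
  rw [smulDeriv, h]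
  exact mfderiv_id

theorem smulDeriv_mul (hdiff : ∀ g : G, MDifferentiable 𝓘(ℝ, E) 𝓘(ℝ, E) fun q : Q => g • q)
    (g h : G) (q : Q) :
    smulDeriv E (g * h) q = (smulDeriv E g (h • q)).comp (smulDeriv E h q) := by
  have h1 : (fun q : Q => (g * h) • q) = (fun q : Q => g • q) ∘ fun q : Q => h • q :=
    funext fun q => mul_smul g h q
  rw [smulDeriv, h1]
  exact mfderiv_comp q (hdiff g (h • q)) (hdiff h q)

theorem isInvertible_smulDeriv
    (hdiff : ∀ g : G, MDifferentiable 𝓘(ℝ, E) 𝓘(ℝ, E) fun q : Q => g • q) (g : G) (q : Q) :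
    (smulDeriv E g q).IsInvertible := by
  refine .of_inverse (g := smulDeriv E g⁻¹ (g • q)) ?_ ?_
  · have h := smulDeriv_mul hdiff g g⁻¹ (g • q)
    rw [mul_inv_cancel, smulDeriv_one, inv_smul_smul] at h
    exact h.symm
  · rw [← smulDeriv_mul hdiff, inv_mul_cancel, smulDeriv_one]

theorem cotangentLift_one (a : CotangentBundle E Q) : cotangentLift (1 : G) a = a := by
  refine cotangentBundle_ext (E := E)
    (A := (a.snd : E →L[ℝ] ℝ).comp (smulDeriv E (1 : G) a.proj).inverse) (A' := a.snd)
    (one_smul G a.proj) ?_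
  rw [smulDeriv_one, ContinuousLinearMap.inverse_id]
  exact ContinuousLinearMap.comp_id (M₁ := E) (M₂ := ℝ) _

theorem cotangentLift_mul (hdiff : ∀ g : G, MDifferentiable 𝓘(ℝ, E) 𝓘(ℝ, E) fun q : Q => g • q)
    (g h : G) (a : CotangentBundle E Q) :
    cotangentLift (g * h) a = cotangentLift g (cotangentLift h a) := by
  refine cotangentBundle_ext (E := E)
    (A := (a.snd : E →L[ℝ] ℝ).comp (smulDeriv E (g * h) a.proj).inverse)
    (A' := ((a.snd : E →L[ℝ] ℝ).comp (smulDeriv E h a.proj).inverse).comp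
      (smulDeriv E g (h • a.proj)).inverse) (mul_smul g h a.proj) ?_
  rw [smulDeriv_mul hdiff, (isInvertible_smulDeriv hdiff g (h • a.proj)).inverse_comp_of_left]
  rfl

theorem isGroupAction_cotangentLift
    (hdiff : ∀ g : G, MDifferentiable 𝓘(ℝ, E) 𝓘(ℝ, E) fun q : Q => g • q) :
    IsGroupAction (cotangentLift (E := E) (Q := Q) (G := G)) :=
  ⟨cotangentLift_one, cotangentLift_mul hdiff⟩

end Cotangent

end CHSystems

open CHSystems in
theorem theorem4p3_general {EP : Type*} [NormedAddCommGroup EP] [NormedSpace ℝ EP]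
    {HP : Type*} [TopologicalSpace HP] {I : ModelWithCorners ℝ EP HP}
    {P : Type*} [TopologicalSpace P] [ChartedSpace HP P] [IsManifold I ∞ P]
    {EW : Type*} [NormedAddCommGroup EW] [NormedSpace ℝ EW]
    {W : Type*} [TopologicalSpace W] [ChartedSpace EW W] [IsManifold 𝓘(ℝ, EW) ∞ W]
    {G : Type*} [Group G] {B : PoissonStructure I P} {Φ : G → P → P} {ι : W → P}
    {D : ∀ z : P, Submodule ℝ (TangentSpace I z)}
    (hΦ : IsGroupAction Φ) (hB : ∀ g, B.IsPoissonMap (Φ g)) (hemb : Topology.IsEmbedding ι)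
    (hι : MDifferentiable 𝓘(ℝ, EW) I ι) (hW : IsGInvariantSet Φ (range ι))
    (hD : IsPoissonDistribution B ι D) (hDG : IsGInvariantDistribution Φ ι D)
    (hext : HasLocalExtensionProperty (EW := EW) Φ ι D) :
    IsPoissonReducible (EW := EW) B Φ ι D ↔
      ∀ n : W, B.sharp (ι n) '' invCodist Φ ι D (ι n)
        ⊆ annihilatorOf (invCodistConst Φ ι D (ι n)) := by
  have hcont (g : G) : Continuous (Φ g) := (hB g).1.continuous
  simp only [sharp_image_invCodist_subset_iff]
  exact ⟨fun hred => hred.vanishingBasicCommuteAt hΦ hcont hemb hι hW hD hDG,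
    isPoissonReducible_of_vanishingBasicCommuteAt hB hι hD
      (cutsOutInvOpens_of_isEmbedding hΦ hcont hemb hW) hext⟩

theorem theorem4p3
    {E : Type*} [NormedAddCommGroup E] [NormedSpace ℝ E] [FiniteDimensional ℝ E]
    {Q : Type*} [TopologicalSpace Q] [ChartedSpace E Q] [IsManifold 𝓘(ℝ, E) ∞ Q]
    [T2Space Q] [SecondCountableTopology Q]
    {EG : Type*} [NormedAddCommGroup EG] [NormedSpace ℝ EG] [FiniteDimensional ℝ EG]
    {G : Type*} [Group G] [TopologicalSpace G] [ChartedSpace EG G] [LieGroup 𝓘(ℝ, EG) ∞ G]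
    [MulAction G Q] [ContMDiffSMul 𝓘(ℝ, EG) 𝓘(ℝ, E) ∞ G Q]
    {EW : Type*} [NormedAddCommGroup EW] [NormedSpace ℝ EW] [FiniteDimensional ℝ EW]
    {W : Type*} [TopologicalSpace W] [ChartedSpace EW W] [IsManifold 𝓘(ℝ, EW) ∞ W] [T2Space W]
    (S : CHSystems.CHSystem E Q EW W) (hS : S.IsSymmetric G)
    (𝒜 : CHSystems.VerticalSplitting E Q)
    (hW : S.IsControllabilitySubmanifold 𝒜)
    (D : ∀ z : CHSystems.CotangentBundle E Q,
      Submodule ℝ (TangentSpace (CHSystems.cotModel E) z))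
    (hD : S.IsControllabilityDistribution D)
    (hDG : CHSystems.IsGInvariantDistribution (CHSystems.cotangentLift (G := G)) S.ι D)
    (hreg : CHSystems.IsRegularDistribution (CHSystems.restrictDist (EW := EW) S.ι D))
    (hext : CHSystems.HasLocalExtensionProperty (EW := EW)
      (CHSystems.cotangentLift (G := G)) S.ι D) :
    CHSystems.IsPoissonReducible (EW := EW) S.B (CHSystems.cotangentLift (G := G)) S.ι D ↔
      ∀ n : W,
        S.B.sharp (S.ι n) '' CHSystems.invCodist (CHSystems.cotangentLift (G := G)) S.ι D (S.ι n)
          ⊆ CHSystems.annihilatorOf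
            (CHSystems.invCodistConst (CHSystems.cotangentLift (G := G)) S.ι D (S.ι n)) :=
  theorem4p3_general
    (CHSystems.isGroupAction_cotangentLift fun g =>
      (ContMDiffSMul.contMDiff_const_smul (I := 𝓘(ℝ, EG)) (n := ∞) g).mdifferentiable (by simp))
    hS.poisson S.ι_embedding.isEmbedding (S.ι_embedding.contMDiff.mdifferentiable (by simp))
    hS.W_inv hD.2.2 hDG hext
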